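/- Let $\mathcal A$ be a finite alphabet and let $\theta:\mathcal A\to\mathcal A^*$ be a substitution, extended to words by concatenation. Let $X=X^\theta\subset\mathcal A^{\mathbb Z}$ be the set of all $x$ such that every finite subword of $x$ is a subword of $\theta^k(a)$ for some $k\ge 0$, $a\in\mathcal A$, and let $T:X\to X$ be the shift. A substitution $\theta$ is called primitive if for all $a,b$ there is $k\ge0$ such that $b$ occurs in $\theta^k(a)$, and $|\theta^k(a)|\to\infty$ for every $a$; it is proper if for some $k\ge 0$ and some letters $\ell,r$ every word $\theta^k(a)$ begins with $\ell$ and ends with $r$; it is aperiodic if $X^\theta$ contains no $T$-periodic point. Assume that $\theta$ is proper, primitive and aperiodic, and let $S:X\to X$ be a homeomorphism of the form $S(x)=T^{p(x)}(x)$ with $p:X\to\mathbb Z^+$ bounded. Labeling. For $k\ge 1$ and $i\in\mathcal A$ let $l_i(k)=|\theta^k(i)|$, and let $A_i(k)$ be the set of the $x\in X$ for which there are $y\in X$ and integers $(n_j)_{j\in\mathbb Z}$ with $n_0=0$, $y_0=i$ and $x[n_j,n_{j+1})=\theta^k(y_j)$, $n_{j+1}=n_j+|\theta^k(y_j)|$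 for all $j$. The sets $T^jA_i(k)$, $0\le j<l_i(k)$, are the floors of column $i$, and $j$ is the height of the floor. Call $k$ large if (1) $p$ is constant on every floor, (2) $l_i(k)>\max p$ for all $i$, and (3) $p$ is constant on $T^n\bigl(\bigcup_iA_i(k)\bigr)$ for $0\le n\le\max p$. In each column, labels $0,1,2,\dots$ are given to the floors successively: the lowest floor that has no label yet, say at height $s$, gets the next label $\ell$, and so does every floor of the same column at a height $j$ such that for some $n\ge0$ one has $s+\sum_{m=0}^{n-1}p(S^mx)=j$ for all $x\in T^sA_i(k)$. Let $c$ be the orbit number of $S$, i.e. the number such that every $T$-orbit is the union of exactly $c$ different $S$-orbits. For $\ell\in\{0,\dots,c-1\}$ let $\pi^{(k)}_i(\ell)$ be the label of the floor containing $S(x)$, for all $x$ in the highest floor of column $i$ with label $\ell$. Substitution. Let $K\ge1$ be such that $K$ is large and $\pi^{(jK)}_i=\pi^{(K)}_i=:\pi_i$ for all $i\in\mathcal A$ and $j\ge1$. Define the substitution $\sigma$ on the alphabet $\mathcal A\times\{0,\dots,c-1\}$ by $$\sigma(i,\ell)=(i_1,\ell_1)(i_2,\ell_2)\cdots(i_m,\ell_m),$$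 where $\theta^K(i)=i_1i_2\cdots i_m$, $\ell_1=\ell$ and $\ell_{r+1}=\pi_{i_r}(\ell_r)$ for $1\le r<m$. Then the orbit number $c\ge 1$ exists, a level $K$ with these properties exists, and for every such $K$ the substitution $\sigma$ is primitive if and only if $S$ is minimal, i.e. every $S$-orbit $\{S^jx:j\in\mathbb Z\}$ is dense in $X$. -/

import Mathlib

namespace Speedup

/-! ### Substitutions -/

section Substitutions

variable {A : Type*}

/-- The extension of `θ : A → A*` to words by concatenation. -/
def extend (θ : A → List A) (w : List A) : List A := w.flatMap θ

/-- The word `θ^k(a)`. -/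
def iter (θ : A → List A) (k : ℕ) (a : A) : List A := (extend θ)^[k] [a]

/-- The word `x[m, m + len)`. -/
def word (x : ℤ → A) (m : ℤ) (len : ℕ) : List A :=
  (List.range len).map fun i => x (m + (i : ℤ))

/-- The subshift `X^θ`: all finite words of `x` are subwords of some `θ^k(a)`. -/
def subshift (θ : A → List A) : Set (ℤ → A) :=
  {x | ∀ (m : ℤ) (len : ℕ), ∃ (k : ℕ) (a : A), word x m len <:+: iter θ k a}

structure IsPrimitive (θ : A → List A) : Prop where
  mem_iter : ∀ a b : A, ∃ k : ℕ, b ∈ iter θ k a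
  length_tendsto : ∀ a : A,
    Filter.Tendsto (fun k => (iter θ k a).length) Filter.atTop Filter.atTop

def IsProper (θ : A → List A) : Prop :=
  ∃ (l r : A) (k : ℕ), ∀ a : A,
    (iter θ k a).head? = some l ∧ (iter θ k a).getLast? = some r

theorem word_shift (x : ℤ → A) (d m : ℤ) (len : ℕ) :
    word (fun n => x (n + d)) m len = word x (m + d) len := by
  unfold word
  apply List.map_congr_left
  intro i _
  show x (m + i + d) = x (m + d + i)
  congr 1
  ring

theorem shift_mem {θ : A → List A} {x : ℤ → A} (hx : x ∈ subshift θ) (d : ℤ) :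
    (fun n => x (n + d)) ∈ subshift θ := by
  intro m len
  rw [word_shift]
  exact hx (m + d) len

/-- The shift `T` on `X^θ`, `(T x)(n) = x(n + 1)`. -/
def shift [TopologicalSpace A] (θ : A → List A) : subshift θ ≃ₜ subshift θ where
  toFun x := ⟨fun n => x.1 (n + 1), shift_mem x.2 1⟩
  invFun x := ⟨fun n => x.1 (n + (-1)), shift_mem x.2 (-1)⟩
  left_inv x := by ext n; simp
  right_inv x := by ext n; simp
  continuous_toFun := by
    apply Continuous.subtype_mk
    exact continuous_pi fun n => (continuous_apply (n + 1)).comp continuous_subtype_val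
  continuous_invFun := by
    apply Continuous.subtype_mk
    exact continuous_pi fun n => (continuous_apply (n + (-1))).comp continuous_subtype_val

/-- `θ` is aperiodic: `X^θ` contains no periodic point of the shift. -/
def IsAperiodic [TopologicalSpace A] (θ : A → List A) : Prop :=
  ∀ (x : subshift θ) (n : ℕ), 0 < n → (shift θ)^[n] x ≠ x

end Substitutions

/-! ### Homeomorphisms and bounded speedups -/

section Dynamics

variable {X : Type*} [TopologicalSpace X]

/-- The two-sided orbit `{f^j x : j ∈ ℤ}`. -/
def orbit (f : X ≃ₜ X) (x : X) : Set X := Set.range fun j : ℤ => (f ^ j) x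

/-- Every orbit is dense. -/
def IsMinimalHomeo (f : X ≃ₜ X) : Prop := ∀ x : X, Dense (orbit f x)

/-- `S` is a bounded speedup of `T` with jump function `p`. -/
structure IsBoundedSpeedup (T S : X ≃ₜ X) (p : X → ℕ) : Prop where
  pos : ∀ x, 0 < p x
  bounded : ∃ M : ℕ, ∀ x, p x ≤ M
  eq_iterate : ∀ x, S x = T^[p x] x

/-- Every `T`-orbit is the union of exactly `c` different `S`-orbits. -/
def IsOrbitNumber (T S : X ≃ₜ X) (c : ℕ) : Prop :=
  ∀ x : X, {O : Set X | (∃ y, O = orbit S y) ∧ O ⊆ orbit T x}.encard = (c : ℕ∞)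

/-- The maximal value of a bounded jump function. -/
noncomputable def maxJump (p : X → ℕ) : ℕ := sSup (Set.range p)

end Dynamics

/-! ### Kakutani-Rokhlin partitions and orbit block labelings -/

section Labeling

variable {A : Type*} [TopologicalSpace A] (θ : A → List A)

/-- `x` is decomposed into the `θ^k`-words `x[n_j, n_{j+1}) = θ^k(y_j)`, `j ∈ ℤ`. -/
def IsDecomposition (k : ℕ) (x y : ℤ → A) (n : ℤ → ℤ) : Prop :=
  ∀ j : ℤ, n (j + 1) = n j + ((iter θ k (y j)).length : ℤ) ∧
    word x (n j) (iter θ k (y j)).length = iter θ k (y j)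

/-- The base `A_i(k)` of the `i`-th column: the points `x` of `X^θ` whose decomposition into
`θ^k`-words has `n_0 = 0` and `x[n_0, n_1) = θ^k(i)`. As usual in the recognizability theory of
substitutions, the sequence of symbols of the decomposition is required to be in `X^θ`. -/
def base (k : ℕ) (i : A) : Set (subshift θ) :=
  {x | ∃ y ∈ subshift θ, ∃ n : ℤ → ℤ, IsDecomposition θ k x.1 y n ∧ n 0 = 0 ∧ y 0 = i}

/-- The number `l_i(k)` of floors of the `i`-th column. -/
def height (k : ℕ) (i : A) : ℕ := (iter θ k i).length

/-- The set `T^j A_i(k)`; it is a floor of the partition for `j < l_i(k)`. -/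
def floor (k : ℕ) (i : A) (j : ℕ) : Set (subshift θ) := (shift θ)^[j] '' base θ k i

variable (S : subshift θ ≃ₜ subshift θ) (p : subshift θ → ℕ)

/-- The three conditions that `k` is large enough for the labeling. -/
structure IsLarge (k : ℕ) : Prop where
  jump_const : ∀ (i : A) (j : ℕ), j < height θ k i →
    ∀ x ∈ floor θ k i j, ∀ y ∈ floor θ k i j, p x = p y
  tall : ∀ i : A, maxJump p < height θ k i
  low_floors : ∀ n ≤ maxJump p,
    ∀ x ∈ (shift θ)^[n] '' (⋃ i, base θ k i), ∀ y ∈ (shift θ)^[n] '' (⋃ i, base θ k i), p x = p y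

/-- The `S`-path which starts on floor `s` of column `i` climbs from floor `s` to floor `j`:
for some `n`, every `x` in floor `s` has `S^n x = T^(j - s) x` with
`j - s = p(x) + p(S x) + ⋯ + p(S^(n-1) x)`. -/
def Climbs (k : ℕ) (i : A) (s j : ℕ) : Prop :=
  ∃ n : ℕ, ∀ x ∈ floor θ k i s, s + ∑ m ∈ Finset.range n, p (S^[m] x) = j

/-- `HasLabel θ S p k i ℓ j`: floor `j` of column `i` gets the label `ℓ`. The lowest floor `s` of
the column without a label `< ℓ` gets the label `ℓ`, and so do the floors of the column that the
`S`-path from floor `s` climbs to. -/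
def HasLabel (k : ℕ) (i : A) (ℓ j : ℕ) : Prop :=
  ∃ s : ℕ, IsLeast {t : ℕ | t < height θ k i ∧ ∀ m, ∀ _ : m < ℓ, ¬ HasLabel k i m t} s ∧
    j < height θ k i ∧ Climbs θ S p k i s j
termination_by ℓ

/-- The floor that contains `x` has the label `ℓ`. -/
def PointHasLabel (k : ℕ) (x : subshift θ) (ℓ : ℕ) : Prop :=
  ∃ (i : A) (j : ℕ), x ∈ floor θ k i j ∧ HasLabel θ S p k i ℓ j

/-- `π` is the tuple `π^(k)`: for all `x` in the highest floor of column `i` with label `ℓ`,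
the label of the floor that contains `S x` is `π_i(ℓ)`. -/
def IsLabelMap {c : ℕ} (k : ℕ) (π : A → Fin c → Fin c) : Prop :=
  ∀ (i : A) (ℓ : Fin c) (j : ℕ), IsGreatest {t : ℕ | HasLabel θ S p k i ℓ t} j →
    ∀ x ∈ floor θ k i j, PointHasLabel θ S p k (S x) (π i ℓ)

/-- The level `K` is large, and `π = π^(K) = π^(2K) = π^(3K) = ⋯`. -/
structure IsStableLevel {c : ℕ} (K : ℕ) (π : A → Fin c → Fin c) : Prop where
  pos : 0 < K
  large : IsLarge θ p K
  labelMap : ∀ j : ℕ, 1 ≤ j → IsLabelMap θ S p (j * K) π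

end Labeling

/-! ### The symbol-label substitution -/

section SymbolLabel

variable {A C : Type*}

/-- `(i_1, ℓ_1)(i_2, ℓ_2)⋯(i_m, ℓ_m)` with `ℓ_1 = ℓ` and `ℓ_{r+1} = π_{i_r}(ℓ_r)`. -/
def labelWord (π : A → C → C) : C → List A → List (A × C)
  | _, [] => []
  | ℓ, i :: w => (i, ℓ) :: labelWord π (π i ℓ) w

/-- The substitution `σ` on `A × C` built from `θ^K` and `π`. -/
def symbolLabel (θ : A → List A) (K : ℕ) (π : A → C → C) : A × C → List (A × C) :=
  fun q => labelWord π q.2 (iter θ K q.1)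

end SymbolLabel

end Speedup

namespace Speedup

/-! ### Words, iterates of a substitution, and compactness of the subshift -/

section Words

variable {A : Type*}

/-! Start at a point `x` of a base of a large level. On the forward orbit `T^n x` the map `S` acts
on positions as the injection `n ↦ n + p(T^n x)`. The positions outside its image (`entries`) are
where `S`-paths enter. They lie below `maxJump p`, and condition (3) makes them the same for all
base points. Hence their number is the orbit number `c` (`encard_orbits`), the label `ℓ` marks the
path from the `ℓ`-th entry (`IsLarge.hasLabel_iff`), and `π^(k)_i` tells at which entry of the next
column this path arrives (`Transfers`, `IsLarge.isLabelMap_iff`).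

Column `i` of level `k + m` is a stack of columns of level `k`, one for each letter of `θ^m(i)`. So
`π^(k+m)_i` is the composite of the maps `π^(k)` along `θ^m(i)` (`Transfers.add`). This is a
recursion on a finite set, hence eventually periodic, which yields stable levels. At a stable level,
`π^(2K) = π^(K)` implies that `σ^n(i, ℓ)` is `θ^(nK)(i)` labelled along the `S`-path with label `ℓ`
(`iter_symbolLabel`). Thus the letter `(i', ℓ')` occurs in it exactly when that path enters, inside
the tall column, a subcolumn `i'` at entry `ℓ'`. If `S` is minimal, bounded return times to that
entry floor force such a visit once the column is tall enough. Conversely, if `σ` is primitive,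
every `S`-path through a tall column meets every floor of a lower level, and floors of high levels
lie inside any given nonempty open set.

All this rests on the floors forming a clopen partition. They cover because their union is closed
and forward invariant while forward `T`-orbits are dense (`exists_mem_floor`). They are disjoint by
`recognizable`, proved by a pigeonhole argument over levels: two different decompositions would
repeat a pattern at two scales, and `eq_of_same_pattern` turns this into a period. -/

theorem extend_iterate (θ : A → List A) (k : ℕ) (w : List A) :
    (extend θ)^[k] w = w.flatMap (iter θ k) := by
  induction w with
  | nil =>
    rw [List.flatMap_nil]
    induction k with
    | zero => rfl
    | succ k ih => rw [Function.iterate_succ_apply', ih]; rfl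
  | cons a w ih =>
    have happ : ∀ (k : ℕ) (u v : List A),
        (extend θ)^[k] (u ++ v) = (extend θ)^[k] u ++ (extend θ)^[k] v := by
      intro k
      induction k with
      | zero => intro u v; rfl
      | succ k ih =>
        intro u v
        simp only [Function.iterate_succ_apply]
        rw [← ih]
        simp [extend]
    rw [List.flatMap_cons, ← ih, ← List.singleton_append, happ]
    rfl

theorem iter_add (θ : A → List A) (k m : ℕ) (a : A) :
    iter θ (k + m) a = (iter θ m a).flatMap (iter θ k) := by
  rw [← extend_iterate]
  exact Function.iterate_add_apply _ _ _ _

theorem IsPrimitive.iter_ne_nil {θ : A → List A} (hθ : IsPrimitive θ) (k : ℕ) (a : A) :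
    iter θ k a ≠ [] := by
  intro h
  obtain ⟨n, hn⟩ := ((hθ.length_tendsto a).eventually_ge_atTop 1).and
    (Filter.eventually_ge_atTop k) |>.exists
  obtain ⟨m, rfl⟩ := Nat.exists_eq_add_of_le hn.2
  rw [add_comm, iter_add, h] at hn
  simp at hn

theorem IsPrimitive.length_pos {θ : A → List A} (hθ : IsPrimitive θ) (k : ℕ) (a : A) :
    0 < (iter θ k a).length := List.length_pos_iff.2 (hθ.iter_ne_nil k a)

theorem length_le_length_flatMap {B : Type*} (w : List A) (f : A → List B)
    (hf : ∀ a ∈ w, f a ≠ []) : w.length ≤ (w.flatMap f).length := by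
  induction w with
  | nil => simp
  | cons a w ih =>
    have h1 := List.length_pos_iff.2 (hf a (by simp))
    have h2 := ih fun b hb => hf b (by simp [hb])
    simp only [List.flatMap_cons, List.length_append, List.length_cons]
    omega

theorem length_flatMap_le {B : Type*} (w : List A) (f : A → List B) (M : ℕ)
    (hf : ∀ a, (f a).length ≤ M) : (w.flatMap f).length ≤ w.length * M := by
  induction w with
  | nil => simp
  | cons a w ih =>
    have h1 := hf a
    simp only [List.flatMap_cons, List.length_append, List.length_cons, add_mul]
    omega

theorem infix_flatMap_of_mem {B : Type*} {w : List A} (f : A → List B) {a : A} (ha : a ∈ w) :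
    f a <:+: w.flatMap f := by
  obtain ⟨s, t, rfl⟩ := List.append_of_mem ha
  exact ⟨s.flatMap f, t.flatMap f, by simp⟩

theorem flatMap_infix_flatMap {B : Type*} {v w : List A} (f : A → List B) (h : v <:+: w) :
    v.flatMap f <:+: w.flatMap f := by
  obtain ⟨s, t, rfl⟩ := h
  exact ⟨s.flatMap f, t.flatMap f, by simp⟩

/-- In a finite alphabet, irreducibility and a self-map `h` with `h a` in all high iterates of `a`
give the uniform form of primitivity. -/
theorem exists_forall_mem_iter {B : Type*} [Finite B] (φ : B → List B)
    (hmem : ∀ a b : B, ∃ k : ℕ, b ∈ iter φ k a) (h : B → B) (n₀ : ℕ)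
    (hh : ∀ n ≥ n₀, ∀ a, h a ∈ iter φ n a) :
    ∃ n₁, ∀ n ≥ n₁, ∀ a b, b ∈ iter φ n a := by
  choose k hk using hmem
  obtain ⟨N, hN⟩ := (Set.finite_range fun q : B × B => k q.1 q.2).bddAbove
  refine ⟨n₀ + N, fun n hn a b => ?_⟩
  have hle : k (h a) b ≤ N := hN ⟨(h a, b), rfl⟩
  obtain ⟨m, rfl⟩ := Nat.exists_eq_add_of_le (show k (h a) b ≤ n by omega)
  rw [iter_add, List.mem_flatMap]
  exact ⟨h a, hh m (by omega) a, hk _ _⟩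

theorem head?_flatMap {B : Type*} (w : List A) (f : A → List B) (a : A) (b : B)
    (hw : w.head? = some a) (hf : (f a).head? = some b) : (w.flatMap f).head? = some b := by
  cases w with
  | nil => simp at hw
  | cons c w =>
    obtain rfl : c = a := by simpa using hw
    simp [hf]

/-- If all words `θ^k₀(a)` begin with `l`, so do the words of all higher levels. -/
theorem IsPrimitive.head?_iter {θ : A → List A} (hθ : IsPrimitive θ) {l : A} {k₀ : ℕ}
    (hl : ∀ a, (iter θ k₀ a).head? = some l) {n : ℕ} (hn : k₀ ≤ n) (a : A) :
    (iter θ n a).head? = some l := by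
  obtain ⟨m, rfl⟩ := Nat.exists_eq_add_of_le hn
  rw [iter_add]
  obtain ⟨b, w, hw⟩ := List.exists_cons_of_ne_nil (hθ.iter_ne_nil m a)
  exact head?_flatMap _ _ b l (by simp [hw]) (hl b)

theorem IsPrimitive.exists_forall_mem [Finite A] {θ : A → List A} (hθ : IsPrimitive θ)
    (hp : IsProper θ) : ∃ n₁, ∀ n ≥ n₁, ∀ a b, b ∈ iter θ n a := by
  obtain ⟨l, r, k₀, hlr⟩ := hp
  refine exists_forall_mem_iter θ hθ.mem_iter (fun _ => l) k₀ fun n hn a => ?_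
  exact List.mem_of_mem_head? (hθ.head?_iter (fun a => (hlr a).1) hn a)

theorem exists_length_iter_le [Finite A] (θ : A → List A) (k : ℕ) :
    ∃ M, ∀ a, (iter θ k a).length ≤ M := by
  obtain ⟨M, hM⟩ := (Set.finite_range fun a => (iter θ k a).length).bddAbove
  exact ⟨M, fun a => hM ⟨a, rfl⟩⟩

/-! ### Words of bi-infinite sequences -/

/-- In the definition of `word` the index list is coerced to a list of integers by a monadic lift;
here the index runs over `ℕ` itself. -/
theorem word_eq_map (x : ℤ → A) (m : ℤ) (len : ℕ) :
    word x m len = (List.range len).map fun i : ℕ => x (m + (i : ℤ)) := by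
  have h : ∀ l : List ℕ, (do let a ← l; pure (a : ℤ) : List ℤ) = l.map fun i : ℕ => (i : ℤ) := by
    intro l
    induction l <;> simp_all
  rw [word, h, List.map_map]
  rfl

@[simp]
theorem length_word (x : ℤ → A) (m : ℤ) (len : ℕ) : (word x m len).length = len := by
  simp [word_eq_map]

theorem getElem_word (x : ℤ → A) (m : ℤ) (len i : ℕ) (h : i < (word x m len).length) :
    (word x m len)[i] = x (m + i) := by
  simp [word_eq_map]

theorem word_add (x : ℤ → A) (m : ℤ) (a b : ℕ) :
    word x m (a + b) = word x m a ++ word x (m + a) b := by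
  simp only [word_eq_map, List.range_add, List.map_append, List.map_map]
  congr 1
  apply List.map_congr_left
  intro i _
  simp [add_assoc]

theorem word_eq_word_iff (x y : ℤ → A) (m m' : ℤ) (len : ℕ) :
    word x m len = word y m' len ↔ ∀ i : ℕ, i < len → x (m + i) = y (m' + i) := by
  simp [word_eq_map]

theorem eq_getElem_of_word_eq {x : ℤ → A} {m : ℤ} {len : ℕ} {w : List A}
    (h : word x m len = w) (i : ℕ) (hi : i < w.length) : x (m + i) = w[i] := by
  subst h
  rw [getElem_word]

theorem word_infix_word (x : ℤ → A) (m m' : ℤ) (len len' : ℕ) (h₁ : m ≤ m')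
    (h₂ : m' + len' ≤ m + len) : word x m' len' <:+: word x m len := by
  obtain ⟨a, ha⟩ := Int.eq_ofNat_of_zero_le (sub_nonneg.2 h₁)
  obtain ⟨b, hb⟩ := Int.eq_ofNat_of_zero_le (sub_nonneg.2 h₂)
  obtain rfl : m' = m + a := by omega
  obtain rfl : len = a + len' + b := by omega
  rw [word_add, word_add]
  exact ⟨_, _, rfl⟩

theorem exists_word_eq_of_infix {x : ℤ → A} {m : ℤ} {len : ℕ} {w : List A}
    (h : w <:+: word x m len) :
    ∃ i : ℤ, m ≤ i ∧ i + w.length ≤ m + len ∧ word x i w.length = w := by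
  obtain ⟨s, t, hst⟩ := h
  have hlen : s.length + w.length + t.length = len := by
    have := congrArg List.length hst
    simpa [add_assoc] using this
  refine ⟨m + s.length, by omega, by omega, ?_⟩
  have h2 := hst
  rw [← hlen, word_add, word_add] at h2
  obtain ⟨h3, -⟩ := List.append_inj h2 (by simp)
  exact (List.append_inj h3 (by simp)).2.symm

/-- A long subword of a concatenation contains one of the concatenated words. -/
theorem exists_infix_of_infix_flatMap {B : Type*} {f : A → List B} {M : ℕ}
    (hf : ∀ a, (f a).length ≤ M) {u : List B} (hu : 2 * M ≤ u.length) (hu' : u ≠ [])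
    {v : List A} (h : u <:+: v.flatMap f) : ∃ b ∈ v, f b <:+: u := by
  obtain ⟨s, t, h⟩ := h
  have hpos := List.length_pos_iff.2 hu'
  induction v generalizing s with
  | nil => simp at h; exact absurd h.2.1 hu'
  | cons b v ih =>
    rw [List.flatMap_cons, List.append_assoc] at h
    rcases List.append_eq_append_iff.1 h with ⟨u₁, h₁, h₂⟩ | ⟨s', h₁, h₂⟩
    · rcases List.append_eq_append_iff.1 h₂ with ⟨r, h₃, h₄⟩ | ⟨u₂, h₃, h₄⟩
      · have h5 := hf b
        rw [h₁, h₃] at h5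
        simp only [List.length_append] at h5
        omega
      · cases v with
        | nil =>
          have h5 := hf b
          have : u₂ = [] := (by simpa using h₄.symm : u₂ = [] ∧ t = []).1
          subst this
          have := congrArg List.length h₁
          have h6 := congrArg List.length h₃
          simp at this h6
          omega
        | cons b' v =>
          refine ⟨b', by simp, ?_⟩
          rw [List.flatMap_cons] at h₄
          have hp : f b' <+: u₂ := by
            apply List.prefix_of_prefix_length_le (l₃ := u₂ ++ t)
            · rw [← h₄]; exact List.prefix_append _ _
            · exact List.prefix_append _ _
            · have h5 := hf b
              have h6 := hf b'
              have := congrArg List.length h₁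
              have h7 := congrArg List.length h₃
              simp at this h7
              omega
          rw [h₃]
          exact hp.isInfix.trans (List.suffix_append _ _).isInfix
    · obtain ⟨c, hc, hc'⟩ := ih s' (by rw [h₂]; simp)
      exact ⟨c, by simp [hc], hc'⟩

theorem exists_split {B : Type*} {f : A → List B} {w : List A} {j : ℕ}
    (hj : j < (w.flatMap f).length) : ∃ u b v, w = u ++ b :: v ∧ (u.flatMap f).length ≤ j ∧
      j < (u.flatMap f).length + (f b).length := by
  induction w generalizing j with
  | nil => simp at hj
  | cons a w ih =>
    by_cases h : j < (f a).length
    · exact ⟨[], a, w, rfl, by simp, by simpa using h⟩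
    · rw [List.flatMap_cons, List.length_append] at hj
      obtain ⟨u, b, v, rfl, h1, h2⟩ := ih (j := j - (f a).length) (by omega)
      exact ⟨a :: u, b, v, rfl, by simp only [List.flatMap_cons, List.length_append]; omega,
        by simp only [List.flatMap_cons, List.length_append]; omega⟩

/-- The language of the subshift is closed under the substitution. -/
theorem subset_iter_of_mem {θ : A → List A} {x : ℤ → A} (hx : x ∈ subshift θ) (m : ℤ) (len k : ℕ) :
    ∃ (j : ℕ) (a : A), (word x m len).flatMap (iter θ k) <:+: iter θ j a := by
  obtain ⟨j, a, h⟩ := hx m len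
  exact ⟨k + j, a, by rw [iter_add]; exact flatMap_infix_flatMap _ h⟩

/-- Every word of the language occurs in all points of the subshift with bounded gaps. -/
theorem exists_window [Finite A] {θ : A → List A} (hθ : IsPrimitive θ) (hp : IsProper θ)
    (w : List A) : ∃ ρ : ℕ, (∃ k a, w <:+: iter θ k a) → ∀ x ∈ subshift θ, ∀ m : ℤ,
      ∃ i : ℤ, m ≤ i ∧ i + w.length ≤ m + ρ ∧ word x i w.length = w := by
  by_cases hw : ∃ k a, w <:+: iter θ k a
  swap
  · exact ⟨0, fun h => absurd h hw⟩
  obtain ⟨k, a, hw⟩ := hw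
  obtain ⟨n₁, hn₁⟩ := hθ.exists_forall_mem hp
  obtain ⟨M, hM⟩ := exists_length_iter_le θ (k + n₁)
  -- A window of length at least `2M` inside a concatenation of blocks of length at most `M`
  -- contains a full block; the extra `1` keeps the window nonempty when `M = 0`.
  refine ⟨2 * M + 1, fun _ x hx m => ?_⟩
  apply exists_word_eq_of_infix
  obtain ⟨j, b, hj⟩ := hx m (2 * M + 1)
  -- Since `b` occurs in `θ^(k+n₁)(b)`, the word `θ^j(b)` is a subword of `θ^(j+k+n₁)(b)`, which is
  -- also a concatenation of `θ^(k+n₁)`-words. Each of these contains `θ^k(a)`, hence `w`.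
  have hj' : word x m (2 * M + 1) <:+: (iter θ j b).flatMap (iter θ (k + n₁)) := by
    refine hj.trans ?_
    rw [← iter_add, add_comm, iter_add]
    exact infix_flatMap_of_mem _ (hn₁ _ (by omega) _ _)
  obtain ⟨d, -, hd⟩ := exists_infix_of_infix_flatMap hM (by simp) (by
    intro h; simpa using congrArg List.length h) hj'
  refine List.IsInfix.trans ?_ hd
  rw [iter_add]
  exact hw.trans (infix_flatMap_of_mem _ (hn₁ _ le_rfl _ _))

/-- Every letter occurs in every point of the subshift. -/
theorem exists_apply_eq [Finite A] {θ : A → List A} (hθ : IsPrimitive θ) (hp : IsProper θ)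
    {x : ℤ → A} (hx : x ∈ subshift θ) (a : A) : ∃ i : ℤ, x i = a := by
  obtain ⟨ρ, hρ⟩ := exists_window hθ hp [a]
  obtain ⟨i, -, -, hi⟩ := hρ ⟨0, a, List.infix_rfl⟩ x hx 0
  exact ⟨i, by simpa [word_eq_map] using hi⟩

theorem isClopen_setOf_word [TopologicalSpace A] [DiscreteTopology A] (P : List A → Prop) (m : ℤ)
    (len : ℕ) : IsClopen {x : ℤ → A | P (word x m len)} := by
  have hc : Continuous fun x : ℤ → A => fun i : Fin len => x (m + (i : ℕ)) :=
    continuous_pi fun i => continuous_apply _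
  have h : {x : ℤ → A | P (word x m len)} = (fun x : ℤ → A => fun i : Fin len => x (m + (i : ℕ))) ⁻¹'
      {f | P (List.ofFn f)} := by
    ext x
    have : word x m len = List.ofFn fun i : Fin len => x (m + (i : ℕ)) := by
      apply List.ext_getElem <;> simp [word_eq_map]
    simp [this]
  rw [h]
  exact (isClopen_discrete _).preimage hc

theorem isClosed_subshift [TopologicalSpace A] [DiscreteTopology A] (θ : A → List A) :
    IsClosed (subshift θ) := by
  simp only [subshift, Set.ofPred_forall]
  exact isClosed_iInter fun m => isClosed_iInter fun len =>
    (isClopen_setOf_word (fun w => ∃ k a, w <:+: iter θ k a) m len).isClosed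

theorem compactSpace_subshift [Finite A] [TopologicalSpace A] [DiscreteTopology A]
    (θ : A → List A) : CompactSpace (subshift θ) :=
  isCompact_iff_compactSpace.1 (isClosed_subshift θ).isCompact

theorem subshift_nonempty [Finite A] [Nonempty A] [TopologicalSpace A] [DiscreteTopology A]
    {θ : A → List A} (hθ : IsPrimitive θ) : (subshift θ).Nonempty := by
  let F : ℕ → Set (ℤ → A) := fun n =>
    {x | ∃ k a, word x (-(n : ℤ)) (2 * n) <:+: iter θ k a}
  have hne : (⋂ n, F n).Nonempty := by
    apply IsCompact.nonempty_iInter_of_sequence_nonempty_isCompact_isClosed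
    · rintro n x ⟨k, a, h⟩
      refine ⟨k, a, List.IsInfix.trans (word_infix_word _ _ _ _ _ ?_ ?_) h⟩ <;> push_cast <;> omega
    · intro n
      obtain ⟨a⟩ := ‹Nonempty A›
      obtain ⟨k, hk⟩ := ((hθ.length_tendsto a).eventually_ge_atTop (2 * n)).exists
      -- Only the letters at positions in `[-n, n)` matter for `F n`; the default letter `a` is mere
      -- padding.
      refine ⟨fun i => (iter θ k a).getD (i + n).toNat a, k, a, ?_⟩
      have : word (fun i : ℤ => (iter θ k a).getD (i + n).toNat a) (-(n : ℤ)) (2 * n)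
          = (iter θ k a).take (2 * n) := by
        apply List.ext_getElem
        · simp [hk]
        · intro i h₁ h₂
          rw [getElem_word]
          simp only [length_word] at h₁
          simp [show i < (iter θ k a).length by omega]
      rw [this]
      exact (List.take_prefix _ _).isInfix
    · exact ((isClopen_setOf_word (fun w => ∃ k a, w <:+: iter θ k a) _ _).isClosed).isCompact
    · intro n
      exact (isClopen_setOf_word (fun w => ∃ k a, w <:+: iter θ k a) _ _).isClosed
  obtain ⟨x, hx⟩ := hne
  refine ⟨x, fun m len => ?_⟩
  obtain ⟨k, a, h⟩ := Set.mem_iInter.1 hx (m.natAbs + len)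
  refine ⟨k, a, List.IsInfix.trans (word_infix_word _ _ _ _ _ ?_ ?_) h⟩ <;> push_cast <;> rcases abs_cases m with h | h <;> omega

end Words

/-! ### Decompositions of bi-infinite sequences into `θ^k`-words -/

section Decompositions

variable {A : Type*} {θ : A → List A}

theorem exists_int_primitive (f : ℤ → ℤ) :
    ∃ n : ℤ → ℤ, n 0 = 0 ∧ ∀ j, n (j + 1) = n j + f j := by
  refine ⟨fun j => ∑ i ∈ Finset.Ico 0 j, f i - ∑ i ∈ Finset.Ico j 0, f i, by simp, fun j => ?_⟩
  rcases le_or_gt 0 j with hj | hj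
  · have h : Finset.Ico 0 (j + 1) = insert j (Finset.Ico 0 j) := by
      ext i; simp only [Finset.mem_Ico, Finset.mem_insert]; omega
    simp [h, Finset.Ico_eq_empty_of_le hj, Finset.Ico_eq_empty_of_le (show (0 : ℤ) ≤ j + 1 by omega),
      add_comm]
  · have h : Finset.Ico j 0 = insert j (Finset.Ico (j + 1) 0) := by
      ext i; simp only [Finset.mem_Ico, Finset.mem_insert]; omega
    simp [h, Finset.Ico_eq_empty_of_le hj.le,
      Finset.Ico_eq_empty_of_le (show j + 1 ≤ 0 by omega)]

theorem exists_int_index {n : ℤ → ℤ} (hn : StrictMono n) (i : ℤ) :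
    ∃ j, n j ≤ i ∧ i < n (j + 1) := by
  have hge : ∀ m : ℕ, n 0 + m ≤ n m := by
    intro m
    induction m with
    | zero => simp
    | succ m ih => have := hn (show (m : ℤ) < (m + 1 : ℕ) by simp); push_cast at *; omega
  have hle : ∀ m : ℕ, n (-m) ≤ n 0 - m := by
    intro m
    induction m with
    | zero => simp
    | succ m ih => have := hn (show (-(m + 1 : ℕ) : ℤ) < -m by simp); push_cast at *; omega
  obtain ⟨j, hj, hj'⟩ := Int.exists_greatest_of_bdd (P := fun j => n j ≤ i)
    ⟨(i - n 0).natAbs + 1, fun z hz => by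
      by_contra h
      have h1 := hge ((i - n 0).natAbs + 1)
      have h2 := hn (not_le.1 h)
      push_cast at *
      have := le_abs_self (i - n 0)
      omega⟩
    ⟨-((i - n 0).natAbs : ℤ), by
      have h1 := hle (i - n 0).natAbs
      have := neg_abs_le (i - n 0)
      push_cast at *
      omega⟩
  exact ⟨j, hj, not_le.1 fun h => by have := hj' _ h; omega⟩

theorem IsDecomposition.strictMono (hθ : IsPrimitive θ) {k : ℕ} {x y : ℤ → A} {n : ℤ → ℤ}
    (h : IsDecomposition θ k x y n) : StrictMono n :=
  strictMono_int_of_lt_succ fun j => by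
    have := hθ.length_pos k (y j)
    rw [(h j).1]
    omega

theorem IsDecomposition.word_flatMap {k : ℕ} {x y : ℤ → A} {n : ℤ → ℤ}
    (h : IsDecomposition θ k x y n) (a : ℤ) (len : ℕ) :
    n (a + len) = n a + ((word y a len).flatMap (iter θ k)).length ∧
      word x (n a) ((word y a len).flatMap (iter θ k)).length
        = (word y a len).flatMap (iter θ k) := by
  induction len with
  | zero => simp [word_eq_map]
  | succ len ih =>
    have h1 : word y (a + len) 1 = [y (a + len)] := by simp [word_eq_map]
    rw [word_add, h1, List.flatMap_append, List.flatMap_singleton, List.length_append, word_add,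
      ih.2, ← ih.1, (h _).2]
    refine ⟨?_, rfl⟩
    push_cast
    rw [← add_assoc, (h _).1, ih.1, add_assoc]

theorem IsDecomposition.shift {k : ℕ} {x y : ℤ → A} {n : ℤ → ℤ}
    (h : IsDecomposition θ k x y n) (d e : ℤ) :
    IsDecomposition θ k (fun i => x (i + d)) (fun i => y (i + e)) fun j => n (j + e) - d := by
  intro j
  obtain ⟨h1, h2⟩ := h (j + e)
  constructor
  · show n (j + 1 + e) - d = _
    rw [add_right_comm, h1]; ring
  · rw [word_shift]
    simpa using h2

theorem exists_decomposition (hθ : IsPrimitive θ) (k : ℕ) (y : ℤ → A) :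
    ∃ x n, IsDecomposition θ k x y n ∧ n 0 = 0 := by
  obtain ⟨n, h0, hn⟩ := exists_int_primitive fun j => ((iter θ k (y j)).length : ℤ)
  have hmono : StrictMono n := strictMono_int_of_lt_succ fun j => by
    have := hθ.length_pos k (y j)
    rw [hn]
    omega
  choose idx hidx using exists_int_index hmono
  refine ⟨fun i => (iter θ k (y (idx i))).getD (i - n (idx i)).toNat (y 0), n,
    fun j => ⟨hn j, ?_⟩, h0⟩
  apply List.ext_getElem
  · simp
  intro i h₁ h₂
  rw [getElem_word]
  have hj : idx (n j + i) = j := by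
    obtain ⟨h3, h4⟩ := hidx (n j + i)
    have h5 : n j < n (idx (n j + i) + 1) := by omega
    have h6 : n (idx (n j + i)) < n (j + 1) := by rw [hn j]; omega
    have h7 := hmono.lt_iff_lt.1 h5
    have h8 := hmono.lt_iff_lt.1 h6
    omega
  simp [hj, h₂]

theorem IsDecomposition.comp {k m : ℕ} {x y z : ℤ → A} {n b : ℤ → ℤ}
    (hy : IsDecomposition θ m y z b) (hx : IsDecomposition θ k x y n) :
    IsDecomposition θ (k + m) x z (n ∘ b) := by
  intro j
  obtain ⟨h1, h2⟩ := hy j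
  obtain ⟨h3, h4⟩ := hx.word_flatMap (b j) (iter θ m (z j)).length
  rw [h2] at h3 h4
  rw [iter_add]
  exact ⟨by simp only [Function.comp, h1, h3], h4⟩

/-- Equal words of letters decompose equal words, forwards from a common cut. -/
theorem IsDecomposition.congr_of_word_eq {k : ℕ} {x y x' y' : ℤ → A} {n n' : ℤ → ℤ}
    (h : IsDecomposition θ k x y n) (h' : IsDecomposition θ k x' y' n') {a a' : ℤ} {len : ℕ}
    (hw : word y a len = word y' a' len) :
    n (a + len) - n a = n' (a' + len) - n' a' ∧
      ∀ i : ℤ, 0 ≤ i → n a + i < n (a + len) → x (n a + i) = x' (n' a' + i) := by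
  obtain ⟨h1, h2⟩ := h.word_flatMap a len
  obtain ⟨h3, h4⟩ := h'.word_flatMap a' len
  rw [← hw] at h3 h4
  refine ⟨by omega, fun i hi hi' => ?_⟩
  obtain ⟨i, rfl⟩ := Int.eq_ofNat_of_zero_le hi
  exact (word_eq_word_iff _ _ _ _ _).1 (h2.trans h4.symm) i (by omega)

/-- Every `θ^k`-word has at least one letter, so the `N` words on either side of the origin cover
`[-N, N)`. This is the continuity of `y ↦ θ^k(y)`. -/
theorem IsDecomposition.congr_local (hθ : IsPrimitive θ) {k : ℕ} {x y x' y' : ℤ → A} {n n' : ℤ → ℤ}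
    (h : IsDecomposition θ k x y n) (h' : IsDecomposition θ k x' y' n') (h0 : n 0 = 0)
    (h0' : n' 0 = 0) {N : ℕ} (hy : ∀ i : ℤ, -N ≤ i → i ≤ N → y i = y' i) :
    ∀ i : ℤ, -N ≤ i → i < N → n i = n' i ∧ x i = x' i := by
  have hw : ∀ (a : ℤ) (len : ℕ), -N ≤ a → a + len ≤ N → word y a len = word y' a len := by
    intro a len h1 h2
    rw [word_eq_word_iff]
    intro i hi
    exact hy _ (by omega) (by omega)
  have hn : ∀ i : ℤ, -N ≤ i → i ≤ N → n i = n' i := by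
    intro i h1 h2
    rcases le_total 0 i with hi | hi
    · obtain ⟨i, rfl⟩ := Int.eq_ofNat_of_zero_le hi
      have := (h.congr_of_word_eq h' (hw 0 i (by omega) (by omega))).1
      simp only [zero_add] at this
      omega
    · obtain ⟨j, hj⟩ := Int.eq_ofNat_of_zero_le (neg_nonneg.2 hi)
      have := (h.congr_of_word_eq h' (hw i j (by omega) (by omega))).1
      rw [show i + (j : ℤ) = 0 by omega] at this
      omega
  have hmono := h.strictMono hθ
  have hge : ∀ m : ℕ, (m : ℤ) ≤ n m := by
    intro m
    induction m with
    | zero => simp [h0]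
    | succ m ih => have := hmono (show (m : ℤ) < (m + 1 : ℕ) by simp); push_cast at *; omega
  have hle : ∀ m : ℕ, n (-m) ≤ -m := by
    intro m
    induction m with
    | zero => simp [h0]
    | succ m ih => have := hmono (show (-(m + 1 : ℕ) : ℤ) < -m by simp); push_cast at *; omega
  intro i h1 h2
  refine ⟨hn i h1 h2.le, ?_⟩
  have h3 := (h.congr_of_word_eq h' (hw (-N) (2 * N) le_rfl (by push_cast; omega))).2
    (i - n (-N)) (by have := hle N; omega) (by
      have := hge N
      rw [show -(N : ℤ) + (2 * N : ℕ) = N by push_cast; ring]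
      omega)
  rw [← hn (-N) le_rfl (by omega)] at h3
  simpa using h3

theorem IsDecomposition.unique (hθ : IsPrimitive θ) {k : ℕ} {x y x' : ℤ → A} {n n' : ℤ → ℤ}
    (h : IsDecomposition θ k x y n) (h' : IsDecomposition θ k x' y n') (h0 : n 0 = n' 0) :
    n = n' ∧ x = x' := by
  have key := fun N : ℕ => (h.shift (n 0) 0).congr_local hθ (h'.shift (n 0) 0) (by simp)
    (by simp [h0]) (N := N) (by simp)
  constructor
  · ext i
    have := (key (i.natAbs + 1) i (by omega) (by omega)).1
    simp only [add_zero] at this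
    omega
  · ext i
    have := (key ((i - n 0).natAbs + 1) (i - n 0) (by omega) (by omega)).2
    simpa using this

theorem IsDecomposition.mem_subshift (hθ : IsPrimitive θ) {k : ℕ} {x y : ℤ → A} {n : ℤ → ℤ}
    (h : IsDecomposition θ k x y n) (hy : y ∈ subshift θ) : x ∈ subshift θ := by
  intro m len
  have hmono := h.strictMono hθ
  obtain ⟨j, hj, -⟩ := exists_int_index hmono m
  obtain ⟨j', hj', hj''⟩ := exists_int_index hmono (m + len)
  have hjj : j < j' + 1 := hmono.lt_iff_lt.1 (by omega)
  obtain ⟨d, hd⟩ := Int.eq_ofNat_of_zero_le (sub_nonneg.2 hjj.le)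
  obtain ⟨h1, h2⟩ := h.word_flatMap j d
  obtain ⟨q, a, hq⟩ := subset_iter_of_mem hy j d k
  refine ⟨q, a, List.IsInfix.trans ?_ hq⟩
  rw [← h2]
  rw [show j + (d : ℤ) = j' + 1 by omega] at h1
  exact word_infix_word _ _ _ _ _ hj (by omega)

/-- Expand `z` by `θ^m` and the result by `θ^k`: after a shift, the composite decomposition has the
same symbols and the same cut at index `0`, so it is the given one. -/
theorem IsDecomposition.refine (hθ : IsPrimitive θ) {k m : ℕ} {x z : ℤ → A} {N : ℤ → ℤ}
    (h : IsDecomposition θ (k + m) x z N) :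
    ∃ y b n, IsDecomposition θ m y z b ∧ b 0 = 0 ∧ IsDecomposition θ k x y n ∧ N = n ∘ b := by
  obtain ⟨y, b, hy, hb⟩ := exists_decomposition hθ m z
  obtain ⟨x', n, hx, hn⟩ := exists_decomposition hθ k y
  have hx' := hx.shift (-(N 0)) 0
  simp only [add_zero] at hx'
  obtain ⟨h1, h2⟩ := (hy.comp hx').unique hθ h (by simp [hb, hn])
  exact ⟨y, b, _, hy, hb, h2 ▸ hx', h1.symm⟩

end Decompositions

/-! ### Bases and floors -/

section Bases

variable {A : Type*} [TopologicalSpace A] {θ : A → List A}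

@[simp]
theorem shift_iterate_apply (x : subshift θ) (m : ℕ) (i : ℤ) :
    ((Speedup.shift θ)^[m] x).1 i = x.1 (i + m) := by
  induction m generalizing i with
  | zero => simp
  | succ m ih =>
    rw [Function.iterate_succ_apply']
    show ((Speedup.shift θ)^[m] x).1 (i + 1) = _
    rw [ih]
    push_cast
    ring_nf

theorem mem_base_of_decomposition {k : ℕ} {x : subshift θ} {y : ℤ → A} {n : ℤ → ℤ}
    (hy : y ∈ subshift θ) (h : IsDecomposition θ k x.1 y n) {j : ℤ} {m : ℕ} (hj : n j = m) :
    (Speedup.shift θ)^[m] x ∈ base θ k (y j) := by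
  refine ⟨fun i => y (i + j), shift_mem hy j, fun i => n (i + j) - m, ?_, by simp [hj], by simp⟩
  convert h.shift m j using 1
  ext i
  simp

theorem exists_shift_height_mem_base {k : ℕ} {i : A} {x : subshift θ} (hx : x ∈ base θ k i) :
    ∃ i', (Speedup.shift θ)^[height θ k i] x ∈ base θ k i' := by
  obtain ⟨y, hy, n, h, h0, rfl⟩ := hx
  refine ⟨y 1, mem_base_of_decomposition hy h ?_⟩
  have := (h 0).1
  rw [h0] at this
  simpa [height] using this

/-- Cutting and stacking: column `i` of level `k + m` is the stack of the columns of level `k` over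
the letters of `θ^m(i)`. -/
theorem base_subset_base (hθ : IsPrimitive θ) {k m : ℕ} {i : A} {x : subshift θ}
    (hx : x ∈ base θ (k + m) i) {u v : List A} {b : A} (hi : iter θ m i = u ++ b :: v) :
    (Speedup.shift θ)^[(u.flatMap (iter θ k)).length] x ∈ base θ k b := by
  obtain ⟨z, hz, N, h, h0, rfl⟩ := hx
  obtain ⟨y, c, n, hyz, hc, hxy, rfl⟩ := h.refine hθ
  have hy := hyz.mem_subshift hθ hz
  have h1 := (hyz 0).2
  rw [hi, hc] at h1
  have hu : word y 0 u.length = u := by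
    have : u.length ≤ (u ++ b :: v).length := by simp
    rw [show (u ++ b :: v).length = u.length + (b :: v).length by simp, word_add] at h1
    exact (List.append_inj h1 (by simp)).1
  have hb : y u.length = b := by
    have := eq_getElem_of_word_eq h1 u.length (by simp)
    simpa using this
  rw [← hb]
  apply mem_base_of_decomposition hy hxy
  have h2 := (hxy.word_flatMap 0 u.length).1
  rw [hu] at h2
  simp only [Function.comp, hc] at h0
  simpa [h0] using h2

theorem base_nonempty [Finite A] [DiscreteTopology A] (hθ : IsPrimitive θ) (hp : IsProper θ)
    (k : ℕ) (i : A) : (base θ k i).Nonempty := by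
  have : Nonempty A := ⟨i⟩
  obtain ⟨y, hy⟩ := subshift_nonempty hθ
  obtain ⟨j, rfl⟩ := exists_apply_eq hθ hp hy i
  obtain ⟨x, n, hx, h0⟩ := exists_decomposition hθ k fun m => y (m + j)
  have hy' := shift_mem hy j
  exact ⟨⟨x, hx.mem_subshift hθ hy'⟩, _, hy', n, hx, h0, by simp⟩

theorem setOf_agree_mem_nhds [DiscreteTopology A] (x : subshift θ) (N : ℕ) :
    {x' : subshift θ | ∀ i : ℤ, -N ≤ i → i ≤ N → x.1 i = x'.1 i} ∈ nhds x := by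
  have h : {x' : subshift θ | ∀ i : ℤ, -N ≤ i → i ≤ N → x.1 i = x'.1 i}
      = ⋂ i ∈ Finset.Icc (-(N : ℤ)) N, {x' : subshift θ | x.1 i = x'.1 i} := by
    ext x'; simp
  rw [h]
  refine (Filter.biInter_finset_mem _).2 fun i _ => ?_
  have hc : Continuous fun x' : subshift θ => x'.1 i :=
    (continuous_apply i).comp continuous_subtype_val
  exact (((isOpen_discrete {a | x.1 i = a}).preimage hc).mem_nhds rfl)

theorem exists_agree_of_isOpen [DiscreteTopology A] {U : Set (subshift θ)} (hU : IsOpen U)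
    {x : subshift θ} (hx : x ∈ U) :
    ∃ N : ℕ, ∀ x' : subshift θ, (∀ i : ℤ, -N ≤ i → i ≤ N → x.1 i = x'.1 i) → x' ∈ U := by
  obtain ⟨V, hV, rfl⟩ := isOpen_induced_iff.1 hU
  obtain ⟨I, u, hu, hIV⟩ := isOpen_pi_iff.1 hV x.1 hx
  refine ⟨I.sup Int.natAbs, fun x' hx' => hIV fun i hi => ?_⟩
  have h1 : i.natAbs ≤ I.sup Int.natAbs := Finset.le_sup (f := Int.natAbs) hi
  rw [← hx' i (by omega) (by omega)]
  exact (hu i hi).2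

/-- The base is the image of the compact cylinder `y_0 = i` under the continuous map `y ↦ θ^k(y)`.
-/
theorem isClosed_base [Finite A] [DiscreteTopology A] (hθ : IsPrimitive θ) (k : ℕ) (i : A) :
    IsClosed (base θ k i) := by
  have := compactSpace_subshift θ
  choose F n hF h0 using exists_decomposition hθ k
  let G : subshift θ → subshift θ := fun y => ⟨F y.1, (hF y.1).mem_subshift hθ y.2⟩
  have hG : Continuous G := by
    refine Continuous.subtype_mk (continuous_pi fun j => ?_) _
    refine continuous_iff_continuousAt.2 fun y => ?_
    refine continuousAt_const.congr (f := fun _ => F y.1 j) ?_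
    filter_upwards [setOf_agree_mem_nhds y (j.natAbs + 1)] with y' hy'
    exact ((hF y.1).congr_local hθ (hF y'.1) (h0 _) (h0 _) hy' j (by omega) (by omega)).2
  have h : base θ k i = G '' {y | y.1 0 = i} := by
    ext x
    constructor
    · rintro ⟨y, hy, m, h1, h2, h3⟩
      refine ⟨⟨y, hy⟩, h3, Subtype.ext ?_⟩
      exact ((hF y).unique hθ h1 ((h0 _).trans h2.symm)).2
    · rintro ⟨y, hy, rfl⟩
      exact ⟨y.1, y.2, n y.1, hF y.1, h0 _, hy⟩
  rw [h]
  have hc : Continuous fun y : subshift θ => y.1 0 :=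
    (continuous_apply 0).comp continuous_subtype_val
  exact (((isClosed_discrete {i}).preimage hc).isCompact.image hG).isClosed

theorem isClosed_floor [Finite A] [DiscreteTopology A] (hθ : IsPrimitive θ) (k : ℕ) (i : A)
    (j : ℕ) : IsClosed (floor θ k i j) := by
  have : floor θ k i j = ⇑((Speedup.shift θ) ^ j) '' base θ k i := by
    rw [floor]
    congr 1
    ext x : 1
    induction j generalizing x with
    | zero => rfl
    | succ j ih => rw [Function.iterate_succ_apply, pow_succ, ih]; rfl
  rw [this]
  exact ((Speedup.shift θ) ^ j).isClosedMap _ (isClosed_base hθ k i)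

/-- Forward orbits of the shift are dense. -/
theorem exists_shift_iterate_mem [Finite A] [DiscreteTopology A] (hθ : IsPrimitive θ)
    (hp : IsProper θ) {U : Set (subshift θ)} (hU : IsOpen U) (hne : U.Nonempty) (x : subshift θ) :
    ∃ m : ℕ, (Speedup.shift θ)^[m] x ∈ U := by
  obtain ⟨z, hz⟩ := hne
  obtain ⟨N, hN⟩ := exists_agree_of_isOpen hU hz
  obtain ⟨ρ, hρ⟩ := exists_window hθ hp (word z.1 (-N) (2 * N + 1))
  obtain ⟨i, hi, -, h⟩ := hρ (z.2 _ _) x.1 x.2 0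
  refine ⟨(i + N).toNat, hN _ fun j h1 h2 => ?_⟩
  rw [length_word, word_eq_word_iff] at h
  have := h (j + N).toNat (by omega)
  rw [shift_iterate_apply]
  rw [show i + ((j + N).toNat : ℤ) = j + ((i + N).toNat : ℤ) by omega,
    show -(N : ℤ) + ((j + N).toNat : ℤ) = j by omega] at this
  exact this.symm

/-- The floors of every level cover the subshift. -/
theorem exists_mem_floor [Finite A] [DiscreteTopology A] (hθ : IsPrimitive θ) (hp : IsProper θ)
    (k : ℕ) (x : subshift θ) : ∃ i j, j < height θ k i ∧ x ∈ floor θ k i j := by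
  let Y : Set (subshift θ) := ⋃ i, ⋃ j ∈ Finset.range (height θ k i), floor θ k i j
  have hmem : ∀ x, x ∈ Y ↔ ∃ i j, j < height θ k i ∧ x ∈ floor θ k i j := by simp [Y]
  have hY : IsClosed Y := isClosed_iUnion_of_finite fun i =>
    isClosed_biUnion_finset fun j _ => isClosed_floor hθ k i j
  have hstep : ∀ x ∈ Y, Speedup.shift θ x ∈ Y := by
    intro x hx
    obtain ⟨i, j, hj, b, hb, rfl⟩ := (hmem x).1 hx
    rw [← Function.iterate_succ_apply' (Speedup.shift θ)]
    by_cases h : j + 1 < height θ k i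
    · exact (hmem _).2 ⟨i, j + 1, h, b, hb, rfl⟩
    · obtain ⟨i', hi'⟩ := exists_shift_height_mem_base hb
      rw [show j.succ = height θ k i by omega]
      exact (hmem _).2 ⟨i', 0, hθ.length_pos k i', _, hi', rfl⟩
  have hiter : ∀ (m : ℕ), ∀ x ∈ Y, (Speedup.shift θ)^[m] x ∈ Y := by
    intro m
    induction m with
    | zero => exact fun x hx => hx
    | succ m ih => intro x hx; rw [Function.iterate_succ_apply]; exact ih _ (hstep x hx)
  rw [← hmem]
  by_contra hx
  obtain ⟨b, hb⟩ := base_nonempty hθ hp k (x.1 0)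
  have hbY : b ∈ Y := (hmem b).2 ⟨_, 0, hθ.length_pos k _, b, hb, rfl⟩
  -- `Y` is closed and forward invariant, so the dense forward orbit of a base point cannot leave
  -- it.
  obtain ⟨m, hm⟩ := exists_shift_iterate_mem hθ hp hY.isOpen_compl ⟨x, hx⟩ b
  exact hm (hiter m b hbY)

end Bases

/-! ### Recognizability and the clopen partition into floors -/

section Recognizability

variable {A : Type*} {θ : A → List A}

theorem IsDecomposition.add_mul_le {k : ℕ} {x y : ℤ → A} {n : ℤ → ℤ}
    (h : IsDecomposition θ k x y n) {μ : ℕ} (hμ : ∀ a, μ ≤ (iter θ k a).length) (a : ℤ) (len : ℕ) :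
    n a + (len * μ : ℕ) ≤ n (a + len) := by
  induction len with
  | zero => simp
  | succ len ih =>
    have h1 := (h (a + len)).1
    have h2 := hμ (y (a + len))
    rw [add_mul]
    push_cast at *
    rw [← add_assoc a, h1]
    omega

theorem IsDecomposition.le_add_mul {k : ℕ} {x y : ℤ → A} {n : ℤ → ℤ}
    (h : IsDecomposition θ k x y n) {M : ℕ} (hM : ∀ a, (iter θ k a).length ≤ M) (a : ℤ) (len : ℕ) :
    n (a + len) ≤ n a + (len * M : ℕ) := by
  induction len with
  | zero => simp
  | succ len ih =>
    have h1 := (h (a + len)).1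
    have h2 := hM (y (a + len))
    rw [add_mul]
    push_cast at *
    rw [← add_assoc a, h1]
    omega

/-- The lengths of the words `θ^k(a)`, `a ∈ A`, are comparable, uniformly in `k`. -/
theorem exists_balanced [Finite A] (hθ : IsPrimitive θ) (hp : IsProper θ) :
    ∃ n₁ C : ℕ, ∀ Q ≥ n₁, ∃ μ M : ℕ, M ≤ C * μ ∧
      ∀ a, μ ≤ (iter θ Q a).length ∧ (iter θ Q a).length ≤ M := by
  obtain ⟨n₁, hn₁⟩ := hθ.exists_forall_mem hp
  obtain ⟨C, hC⟩ := exists_length_iter_le θ n₁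
  refine ⟨n₁, C, fun Q hQ => ?_⟩
  obtain ⟨q, rfl⟩ := Nat.exists_eq_add_of_le' hQ
  have : Nonempty A := ⟨hp.choose⟩
  obtain ⟨b, hb⟩ := Finite.exists_max fun a => (iter θ q a).length
  refine ⟨(iter θ q b).length, C * (iter θ q b).length, le_rfl, fun a => ?_⟩
  rw [iter_add]
  exact ⟨(infix_flatMap_of_mem (iter θ q) (hn₁ _ le_rfl a b)).length_le,
    (length_flatMap_le _ _ _ hb).trans (Nat.mul_le_mul_right _ (hC a))⟩

/-- Words of a given length occur in all windows of a common length. -/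
theorem exists_window_length [Finite A] (hθ : IsPrimitive θ) (hp : IsProper θ) (len : ℕ) :
    ∃ ρ : ℕ, ∀ z ∈ subshift θ, ∀ z' ∈ subshift θ, ∀ t m : ℤ,
      ∃ i : ℤ, m ≤ i ∧ i + len ≤ m + ρ ∧ word z' i len = word z t len := by
  choose ρ hρ using fun w => exists_window hθ hp w
  obtain ⟨N, hN⟩ := (Set.finite_range fun f : Fin len → A => ρ (List.ofFn f)).bddAbove
  refine ⟨N, fun z hz z' hz' t m => ?_⟩
  obtain ⟨i, h1, h2, h3⟩ := hρ (word z t len) (hz t len) z' hz' m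
  have hle : ρ (word z t len) ≤ N := hN ⟨fun i : Fin len => z (t + (i : ℕ)), by
    show ρ _ = ρ _
    congr 1
    apply List.ext_getElem <;> simp [word_eq_map]⟩
  rw [length_word] at h2 h3
  exact ⟨i, h1, by omega, h3⟩

/-- A period on an interval which consists of many `θ^Q`-words is a global period. -/
theorem IsDecomposition.periodic_of_window (hθ : IsPrimitive θ) {Q : ℕ} {x z : ℤ → A}
    {N : ℤ → ℤ} (h : IsDecomposition θ Q x z N) {C μ ρ : ℕ}
    (hμ : ∀ a, μ ≤ (iter θ Q a).length)
    (hρ : ∀ t m : ℤ, ∃ i : ℤ, m ≤ i ∧ i + (C + 1 : ℕ) ≤ m + ρ ∧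
      word z i (C + 1) = word z t (C + 1))
    {d : ℕ} (hd : d ≤ C * μ) {I I' : ℤ} (hI : ∀ i, I ≤ i → i < I' → x i = x (i + d))
    {j : ℤ} (hj : I ≤ N j) (hj' : N (j + ρ) ≤ I') (i : ℤ) : x i = x (i + d) := by
  have hmono := h.strictMono hθ
  obtain ⟨t, ht, ht'⟩ := exists_int_index hmono i
  obtain ⟨j', h1, h2, h3⟩ := hρ t j
  obtain ⟨h4, h5⟩ := h.congr_of_word_eq h h3.symm
  have h6 := h.add_mul_le hμ (t + 1) C
  have h7 : N (t + (C + 1 : ℕ)) = N (t + 1 + C) := by congr 1; push_cast; ring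
  have h8 := hmono.monotone h1
  have h9 := hmono.monotone h2
  have e1 := h5 (i - N t) (by omega) (by omega)
  have e2 := h5 (i + d - N t) (by omega) (by omega)
  have e3 := hI (N j' + (i - N t)) (by omega) (by omega)
  -- The `C + 1` cells from the one containing `i` also reach `i + d`, as `d ≤ C μ`; a copy of them
  -- lies in the window, where the period is known.
  rw [show N t + (i - N t) = i by ring] at e1
  rw [show N t + (i + d - N t) = i + d by ring] at e2
  rw [e1, e3, e2]
  congr 1
  ring

/-- If two decompositions of `x` have, at two scales, the same letters to the right of the
origin, then they agree at the origin. -/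
theorem eq_of_same_pattern (hθ : IsPrimitive θ) {x : ℤ → A}
    (haper : ∀ d : ℕ, 0 < d → ∃ i, x i ≠ x (i + d)) {k e Q C μ M ρ : ℕ}
    {y y' z z' w w' : ℤ → A} {n n' N N' a a' : ℤ → ℤ}
    (hy : IsDecomposition θ k x y n) (hy' : IsDecomposition θ k x y' n')
    (hn : n 0 ≤ 0 ∧ 0 < n 1) (hn' : n' 0 ≤ 0 ∧ 0 < n' 1)
    (hz : IsDecomposition θ Q x z N) (hz' : IsDecomposition θ Q x z' N')
    (hN : 0 < N 1) (hN' : N' 0 ≤ 0)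
    (hw : IsDecomposition θ (e + Q) y w a) (hw' : IsDecomposition θ (e + Q) y' w' a')
    (ha : 0 < a 1) (ha' : a' 0 ≤ 0 ∧ 0 < a' 1)
    (hM : ∀ b, μ ≤ (iter θ (k + (e + Q)) b).length ∧ (iter θ (k + (e + Q)) b).length ≤ M)
    (hC : M ≤ C * μ)
    (hρ : ∀ t m : ℤ, ∃ i : ℤ, m ≤ i ∧ i + (C + 1 : ℕ) ≤ m + ρ ∧
      word w i (C + 1) = word w t (C + 1))
    (hpat : ∀ i : ℕ, i < (1 + ρ) * C + 1 → z i = w i)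
    (hpat' : ∀ i : ℕ, i < (1 + ρ) * C + 1 → z' i = w' i)
    (hle : N 0 ≤ N' 0) (hle' : n (a 0) ≤ n' (a' 0)) : n 0 = n' 0 ∧ y 0 = y' 0 := by
  -- Insert the level in between: `u` gives a decomposition of `x` into `θ^(k+e)`-words, and `u`
  -- itself is decomposed into `θ^Q`-words with letters `w`, just as `x` is with letters `z`.
  obtain ⟨u, b, α, hu, hb, hyu, rfl⟩ := hw.refine hθ
  obtain ⟨u', b', α', hu', hb', hyu', rfl⟩ := hw'.refine hθ
  have hV := hyu.comp hy
  have hV' := hyu'.comp hy'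
  have hW := hu.comp hV
  have hW' := hu'.comp hV'
  rw [add_assoc] at hW hW'
  set V := n ∘ α with hVdef
  set V' := n' ∘ α' with hVdef'
  simp only [Function.comp] at ha ha' hle'
  have hVm := hV.strictMono hθ
  have hVm' := hV'.strictMono hθ
  have hnm := hy.strictMono hθ
  have hnm' := hy'.strictMono hθ
  have hbm := hu.strictMono hθ
  have hbm' := hu'.strictMono hθ
  have v0 : n (α (b 0)) = V 0 := by rw [hb]; rfl
  have v0' : n' (α' (b' 0)) = V' 0 := by rw [hb']; rfl
  have v1 : 0 < V (b 1) := hn.2.trans_le (hnm.monotone (by omega))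
  have v1' : 0 < V' (b' 1) := hn'.2.trans_le (hnm'.monotone (by omega))
  have v2' : V' 0 ≤ 0 := by rw [← v0']; exact (hnm'.monotone ha'.1).trans hn'.1
  rw [v0, v0'] at hle'
  -- One cell may be lost because the comparison starts at `s` inside cell `0`; the other `(1 + ρ)
  -- C` cells have total length at least `(1 + ρ) M`.
  set R := (1 + ρ) * C + 1 with hR
  have hwR : ∀ len ≤ R, word w 0 len = word z 0 len := fun len hlen => by
    rw [word_eq_word_iff]; intro i hi; simp [hpat i (by omega)]
  have hwR' : ∀ len ≤ R, word w' 0 len = word z' 0 len := fun len hlen => by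
    rw [word_eq_word_iff]; intro i hi; simp [hpat' i (by omega)]
  obtain ⟨-, hux⟩ := hu.congr_of_word_eq hz (hwR R le_rfl)
  obtain ⟨-, hux'⟩ := hu'.congr_of_word_eq hz' (hwR' R le_rfl)
  obtain ⟨hb1, -⟩ := hu.congr_of_word_eq hz (hwR 1 (by omega))
  simp only [hb, hb', zero_add, Nat.cast_one, sub_zero] at hux hux' hb1
  obtain ⟨s, hs⟩ := Int.eq_ofNat_of_zero_le (sub_nonneg.2 hle)
  have hs1 : (s : ℤ) < b 1 := by omega
  -- By the equal patterns `u` and `u'` copy `x` from `N 0` and from `N' 0` on, so `u'` from `0` on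
  -- reads like `u` from `s = N' 0 - N 0` on.
  have huu : ∀ L : ℕ, (L : ℤ) ≤ b' R → s + L ≤ b R → word u' 0 L = word u s L := by
    intro L h1 h2
    rw [word_eq_word_iff]
    intro i hi
    rw [zero_add, hux' i (by omega) (by omega), hux (s + i) (by omega) (by omega)]
    congr 1
    omega
  have hR1 : (1 : ℤ) ≤ R := by omega
  have hbR := hbm.monotone hR1
  have hbR' := hbm'.monotone hR1
  have hb1' : 0 < b' 1 := by rw [← hb']; exact hbm' (by simp)
  -- If the cuts `V' 0` and `V s` coincide, the two decompositions run in step from there past the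
  -- origin. Otherwise `x` repeats itself at the distance between these cuts.
  by_cases hcase : V' 0 = V s
  · obtain ⟨L, hL⟩ := Int.eq_ofNat_of_zero_le
      (show (0 : ℤ) ≤ min (b' 1) (b 1 - s) by rw [le_min_iff]; omega)
    have hVL : ∀ i : ℕ, i ≤ L → V' i = V (s + i) := by
      intro i hi
      have := (hV'.congr_of_word_eq hV (huu i (by omega) (by omega))).1
      rw [zero_add] at this
      omega
    have hLpos : 0 < V' L := by
      rcases min_choice (b' 1) (b 1 - s) with h | h
      · rw [← hL, h]; exact v1'
      · rw [hVL L le_rfl, ← hL, h, add_sub_cancel]; exact v1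
    obtain ⟨t, ht, ht'⟩ := exists_int_index hVm' 0
    have ht0 : 0 < t + 1 := hVm'.lt_iff_lt.1 (v2'.trans_lt ht')
    have htL : t < L := hVm'.lt_iff_lt.1 (ht.trans_lt hLpos)
    obtain ⟨t, rfl⟩ := Int.eq_ofNat_of_zero_le (show 0 ≤ t by omega)
    have hut : word u' t 1 = word u (s + t) 1 := by
      have := huu (t + 1) (by push_cast; omega) (by push_cast; omega)
      rw [word_add, word_add] at this
      simpa using (List.append_inj this (by simp)).2
    obtain ⟨-, hyy⟩ := hyu'.congr_of_word_eq hyu hut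
    have hnt : n' (α' t) = n (α (s + t)) := hVL t (by omega)
    have hα : α' t < 1 := hnm'.lt_iff_lt.1 (lt_of_le_of_lt ht hn'.2)
    have hα' : 0 < α' (t + 1) := hnm'.lt_iff_lt.1 (hn'.1.trans_lt ht')
    obtain ⟨i, hi⟩ := Int.eq_ofNat_of_zero_le (show 0 ≤ -α' t by omega)
    have hword : ∀ m ≤ i + 1, word y' (α' t) m = word y (α (s + t)) m := by
      intro m hm
      rw [word_eq_word_iff]
      intro r hr
      exact hyy r (by omega) (by push_cast; omega)
    have e1 := (hy'.congr_of_word_eq hy (hword i (by omega))).1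
    have e2 := (hy'.congr_of_word_eq hy (hword (i + 1) le_rfl)).1
    have e3 := hyy i (by omega) (by push_cast; omega)
    rw [show α' t + (i : ℤ) = 0 by omega] at e1 e3
    rw [show α' t + ((i + 1 : ℕ) : ℤ) = 1 by push_cast; omega] at e2
    have h0 : α (s + t) + i = 0 := by
      have g1 : α (s + t) + i < 1 := hnm.lt_iff_lt.1 (by omega)
      have g2 : 0 < α (s + t) + (i + 1 : ℕ) := hnm.lt_iff_lt.1 (by omega)
      push_cast at g2
      omega
    rw [h0] at e1 e3
    exact ⟨by omega, e3.symm⟩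
  · exfalso
    obtain ⟨L, hL⟩ := Int.eq_ofNat_of_zero_le
      (show (0 : ℤ) ≤ min (b' R) (b R - s) by rw [le_min_iff]; omega)
    obtain ⟨hlen, hxx⟩ := hV'.congr_of_word_eq hV (huu L (by omega) (by omega))
    rw [zero_add] at hlen hxx
    have hμ := fun b => (hM b).1
    have hVs : V 0 ≤ V s := hVm.monotone (by omega)
    have hVs' : V s ≤ V (b 1) := hVm.monotone hs1.le
    have hΛ : ((1 + ρ) * C * μ : ℕ) ≤ V' L - V' 0 := by
      rcases min_choice (b' R) (b R - s) with h | h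
      · have h1 := hW'.add_mul_le hμ 0 R
        rw [zero_add] at h1
        have h2 : (V' ∘ b') 0 = V' 0 := by simp [hb']
        have h3 : (V' ∘ b') R = V' L := by rw [← hL, h]; rfl
        have h4 : R * μ = (1 + ρ) * C * μ + μ := by rw [hR]; ring
        rw [h4] at h1
        omega
      · have h1 := hW.add_mul_le hμ 1 ((1 + ρ) * C)
        have h2 : (V ∘ b) (1 + ((1 + ρ) * C : ℕ)) = V (s + L) := by
          rw [← hL, h, add_sub_cancel, hR]
          simp [add_comm]
        have h3 : (V ∘ b) 1 = V (b 1) := rfl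
        omega
    have hMb := hW.le_add_mul (fun b => (hM b).2) 0 (1 + ρ)
    have hM1 := hW.le_add_mul (fun b => (hM b).2) 0 1
    have h00 : (V ∘ b) 0 = V 0 := by simp [hb]
    have h01 : (V ∘ b) (0 + (1 : ℕ)) = V (b 1) := by simp
    have hMC : (1 + ρ) * M ≤ (1 + ρ) * C * μ := by
      rw [mul_assoc]; exact Nat.mul_le_mul_left _ hC
    rw [h00] at hMb hM1
    rw [h01, one_mul] at hM1
    -- Both cuts lie between `V 0` and `V (b 1)`, the ends of one cell; `hle'` gives the lower bound
    -- for `V' 0`.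
    have hd : (V' 0 - V s).natAbs ≤ C * μ := by omega
    obtain ⟨i, hi⟩ := haper (V' 0 - V s).natAbs (by omega)
    refine hi (hW.periodic_of_window hθ hμ hρ hd (I := min (V' 0) (V s))
      (I' := min (V' 0) (V s) + (V' L - V' 0)) ?_ (j := 1) ?_ ?_ i)
    · intro i h1 h2
      rcases le_total (V' 0) (V s) with h | h
      · rw [min_eq_left h] at h1 h2
        have := hxx (i - V' 0) (by omega) (by omega)
        rw [show V' 0 + (i - V' 0) = i by ring] at this
        rw [this]
        congr 1
        omega
      · rw [min_eq_right h] at h1 h2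
        have := hxx (i - V s) (by omega) (by omega)
        rw [show V s + (i - V s) = i by ring] at this
        rw [← this]
        congr 1
        omega
    · show _ ≤ V (b 1)
      exact (min_le_right _ _).trans hVs'
    · have : (V ∘ b) (1 + (ρ : ℤ)) = (V ∘ b) (0 + (1 + ρ : ℕ)) := by
        congr 1; push_cast; ring
      rw [this]
      have h5 : V 0 ≤ min (V' 0) (V s) := le_min hle' hVs
      omega

variable [TopologicalSpace A]

theorem exists_decomposition_of_mem [Finite A] [DiscreteTopology A] (hθ : IsPrimitive θ)
    (hp : IsProper θ) (k : ℕ) {x : ℤ → A} (hx : x ∈ subshift θ) :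
    ∃ y ∈ subshift θ, ∃ n, IsDecomposition θ k x y n ∧ n 0 ≤ 0 ∧ 0 < n 1 := by
  obtain ⟨i, j, hj, b, ⟨y, hy, n, h, h0, rfl⟩, hb⟩ := exists_mem_floor hθ hp k ⟨x, hx⟩
  refine ⟨y, hy, fun m => n m - j, ?_, by simp [h0], ?_⟩
  · have hx' : x = fun i => b.1 (i + j) := by
      ext i
      rw [← shift_iterate_apply, hb]
    simpa [← hx'] using h.shift j 0
  · have h1 := (h 0).1
    rw [h0, zero_add, zero_add] at h1
    rw [height] at hj
    show 0 < n 1 - j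
    omega

theorem IsAperiodic.exists_ne (haper : IsAperiodic θ) {x : ℤ → A} (hx : x ∈ subshift θ) {d : ℕ}
    (hd : 0 < d) : ∃ i, x i ≠ x (i + d) := by
  by_contra! h
  refine haper ⟨x, hx⟩ d hd (Subtype.ext (funext fun i => ?_))
  rw [shift_iterate_apply]
  exact (h i).symm

/-- Recognizability: the decomposition of a point of the subshift into `θ^k`-words is unique. -/
theorem recognizable [Finite A] [DiscreteTopology A] (hθ : IsPrimitive θ) (hp : IsProper θ)
    (haper : IsAperiodic θ) {x : ℤ → A} (hx : x ∈ subshift θ) {k : ℕ} {y y' : ℤ → A}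
    {n n' : ℤ → ℤ} (hyX : y ∈ subshift θ) (hyX' : y' ∈ subshift θ)
    (hy : IsDecomposition θ k x y n) (hy' : IsDecomposition θ k x y' n')
    (hn : n 0 ≤ 0 ∧ 0 < n 1) (hn' : n' 0 ≤ 0 ∧ 0 < n' 1) : n 0 = n' 0 ∧ y 0 = y' 0 := by
  obtain ⟨n₁, C, hbal⟩ := exists_balanced hθ hp
  obtain ⟨ρ, hρ⟩ := exists_window_length hθ hp (C + 1)
  -- The spacing `k + 1` lets a decomposition of `x` at level `k + (t₁ (k + 1) + n₁)` be compared
  -- with one of `y` at the higher level `t₂ (k + 1) + n₁`.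
  choose z hz a hza ha0 ha1 using
    fun t : ℕ => exists_decomposition_of_mem hθ hp (t * (k + 1) + n₁) hyX
  choose z' hz' a' hza' ha0' ha1' using
    fun t : ℕ => exists_decomposition_of_mem hθ hp (t * (k + 1) + n₁) hyX'
  have hnm := hy.strictMono hθ
  have hnm' := hy'.strictMono hθ
  have key : ∃ t₁ t₂, t₁ < t₂ ∧ (∀ i : ℕ, i < (1 + ρ) * C + 1 → z t₁ i = z t₂ i) ∧
      (∀ i : ℕ, i < (1 + ρ) * C + 1 → z' t₁ i = z' t₂ i) ∧
      (n (a t₁ 0) ≤ n' (a' t₁ 0) ↔ n (a t₂ 0) ≤ n' (a' t₂ 0)) := by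
    -- Pigeonhole: at each scale the patterns to the right of the origin and the order of the two
    -- cuts take finitely many values.
    obtain ⟨t₁, t₂, hne, heq⟩ := Finite.exists_ne_map_eq_of_infinite fun t : ℕ =>
      ((fun i : Fin ((1 + ρ) * C + 1) => z t (i : ℕ)),
        (fun i : Fin ((1 + ρ) * C + 1) => z' t (i : ℕ)), n (a t 0) ≤ n' (a' t 0))
    simp only [Prod.mk.injEq, eq_iff_iff] at heq
    have g1 : ∀ i : ℕ, i < (1 + ρ) * C + 1 → z t₁ i = z t₂ i :=
      fun i hi => congrFun heq.1 ⟨i, hi⟩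
    have g2 : ∀ i : ℕ, i < (1 + ρ) * C + 1 → z' t₁ i = z' t₂ i :=
      fun i hi => congrFun heq.2.1 ⟨i, hi⟩
    rcases lt_or_gt_of_ne hne with h | h
    · exact ⟨t₁, t₂, h, g1, g2, heq.2.2⟩
    · exact ⟨t₂, t₁, h, fun i hi => (g1 i hi).symm, fun i hi => (g2 i hi).symm, heq.2.2.symm⟩
  obtain ⟨t₁, t₂, hlt, hp1, hp2, hord⟩ := key
  obtain ⟨e, he⟩ : ∃ e, t₂ * (k + 1) + n₁ = e + (k + (t₁ * (k + 1) + n₁)) := by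
    obtain ⟨d, rfl⟩ := Nat.exists_eq_add_of_lt hlt
    exact ⟨d * (k + 1) + 1, by ring⟩
  obtain ⟨μ, M, hC, hM⟩ := hbal (k + (e + (k + (t₁ * (k + 1) + n₁)))) (by omega)
  have hz1 := (hza t₁).comp hy
  have hz1' := (hza' t₁).comp hy'
  have hz2 := hza t₂
  have hz2' := hza' t₂
  rw [he] at hz2 hz2'
  rcases le_total (n (a t₁ 0)) (n' (a' t₁ 0)) with h | h
  · exact eq_of_same_pattern hθ (fun d => haper.exists_ne hx) hy hy' hn hn' hz1 hz1'
      (hn.2.trans_le (hnm.monotone (ha1 t₁))) ((hnm'.monotone (ha0' t₁)).trans hn'.1) hz2 hz2'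
      (ha1 t₂) ⟨ha0' t₂, ha1' t₂⟩ hM hC (fun t m => hρ _ (hz t₂) _ (hz t₂) t m) hp1 hp2 h
      (hord.1 h)
  · by_cases heq : n (a t₁ 0) = n' (a' t₁ 0)
    · exact eq_of_same_pattern hθ (fun d => haper.exists_ne hx) hy hy' hn hn' hz1 hz1'
        (hn.2.trans_le (hnm.monotone (ha1 t₁))) ((hnm'.monotone (ha0' t₁)).trans hn'.1) hz2 hz2'
        (ha1 t₂) ⟨ha0' t₂, ha1' t₂⟩ hM hC (fun t m => hρ _ (hz t₂) _ (hz t₂) t m) hp1 hp2 heq.le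
        (hord.1 heq.le)
    · have h2 : n' (a' t₂ 0) ≤ n (a t₂ 0) := by
        by_contra hcon
        have := hord.2 (not_le.1 hcon).le
        omega
      obtain ⟨r1, r2⟩ := eq_of_same_pattern hθ (fun d => haper.exists_ne hx) hy' hy hn' hn hz1' hz1
        (hn'.2.trans_le (hnm'.monotone (ha1' t₁))) ((hnm.monotone (ha0 t₁)).trans hn.1) hz2' hz2
        (ha1' t₂) ⟨ha0 t₂, ha1 t₂⟩ hM hC (fun t m => hρ _ (hz' t₂) _ (hz' t₂) t m) hp2 hp1 h h2
      exact ⟨r1.symm, r2.symm⟩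

/-- The floors of a level are pairwise disjoint. -/
theorem floor_unique [Finite A] [DiscreteTopology A] (hθ : IsPrimitive θ) (hp : IsProper θ)
    (haper : IsAperiodic θ) {k : ℕ} {i i' : A} {j j' : ℕ} {x : subshift θ}
    (hx : x ∈ floor θ k i j) (hj : j < height θ k i) (hx' : x ∈ floor θ k i' j')
    (hj' : j' < height θ k i') : i = i' ∧ j = j' := by
  have key : ∀ {i : A} {j : ℕ}, x ∈ floor θ k i j → j < height θ k i →
      ∃ y ∈ subshift θ, ∃ n, IsDecomposition θ k x.1 y n ∧ n 0 = -j ∧ 0 < n 1 ∧ y 0 = i := by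
    rintro i j ⟨b, ⟨y, hy, n, h, h0, rfl⟩, rfl⟩ hj
    refine ⟨y, hy, fun m => n m - j, ?_, by simp [h0], ?_, rfl⟩
    · convert h.shift j 0 using 1 <;> ext i <;> simp
    · have h1 := (h 0).1
      rw [h0, zero_add, zero_add] at h1
      rw [height] at hj
      show 0 < n 1 - j
      omega
  obtain ⟨y, hy, n, h1, h2, h3, h4⟩ := key hx hj
  obtain ⟨y', hy', n', h1', h2', h3', h4'⟩ := key hx' hj'
  have := recognizable hθ hp haper x.2 hy hy' h1 h1' ⟨by omega, h3⟩ ⟨by omega, h3'⟩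
  exact ⟨by rw [← h4, ← h4', this.2], by omega⟩

theorem isOpen_floor [Finite A] [DiscreteTopology A] (hθ : IsPrimitive θ) (hp : IsProper θ)
    (haper : IsAperiodic θ) {k : ℕ} {i : A} {j : ℕ} (hj : j < height θ k i) :
    IsOpen (floor θ k i j) := by
  classical
  have : Fintype A := Fintype.ofFinite A
  let F : Finset ((_ : A) × ℕ) :=
    (Finset.univ.sigma fun i' => Finset.range (height θ k i')).erase ⟨i, j⟩
  -- Closed pieces of a finite partition are open.
  have h : floor θ k i j = (⋃ q ∈ F, floor θ k q.1 q.2)ᶜ := by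
    ext x
    constructor
    · intro hx
      simp only [Set.mem_compl_iff, Set.mem_iUnion, not_exists]
      rintro ⟨i', j'⟩ hq hx'
      simp only [F, Finset.mem_erase, Finset.mem_sigma, Finset.mem_univ, Finset.mem_range,
        true_and] at hq
      obtain ⟨rfl, rfl⟩ := floor_unique hθ hp haper hx hj hx' hq.2
      exact hq.1 rfl
    · intro hx
      obtain ⟨i', j', hj', hx'⟩ := exists_mem_floor hθ hp k x
      by_contra hcon
      refine hx (Set.mem_biUnion (x := (⟨i', j'⟩ : (_ : A) × ℕ)) ?_ hx')
      simp only [F, Finset.coe_erase, Set.mem_sdiff, Finset.mem_coe, Finset.mem_sigma,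
        Finset.mem_univ, Finset.mem_range, true_and, hj', Set.mem_singleton_iff]
      intro heq
      cases heq
      exact hcon hx'
  rw [h]
  exact (isClosed_biUnion_finset fun q _ => isClosed_floor hθ k q.1 q.2).isOpen_compl

end Recognizability

/-! ### Local constancy of the jump function, and large levels -/

section Large

variable {A : Type*} {θ : A → List A}

theorem word_suffix_of_mem_base {m k₀ : ℕ} {r : A}
    (hr : ∀ a, (iter θ k₀ a).getLast? = some r) {i : A} {x : subshift θ}
    (hx : x ∈ base θ (m + k₀) i) :
    word x.1 (-(iter θ m r).length) (iter θ m r).length = iter θ m r := by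
  obtain ⟨y, -, n, h, h0, -⟩ := hx
  obtain ⟨h1, h2⟩ := h (-1)
  obtain ⟨w, hw⟩ := List.getLast?_eq_some_iff.1 (hr (y (-1)))
  rw [iter_add, hw, List.flatMap_append, List.flatMap_singleton, List.length_append] at h1 h2
  rw [word_add] at h2
  have h3 := (List.append_inj h2 (by simp)).2
  rw [neg_add_cancel, h0] at h1
  rw [← show n (-1) + ((w.flatMap (iter θ m)).length : ℤ) = -(iter θ m r).length by
    push_cast at h1; omega]
  exact h3

theorem word_of_mem_base {k : ℕ} {i : A} {x : subshift θ} (hx : x ∈ base θ k i) :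
    word x.1 0 (height θ k i) = iter θ k i := by
  obtain ⟨y, -, n, h, h0, rfl⟩ := hx
  simpa [h0, height] using (h 0).2

variable [TopologicalSpace A]

theorem word_prefix_of_mem_base (hθ : IsPrimitive θ) {m k₀ : ℕ} {l : A}
    (hl : ∀ a, (iter θ k₀ a).head? = some l) {i : A} {x : subshift θ}
    (hx : x ∈ base θ (m + k₀) i) :
    word x.1 0 (iter θ m l).length = iter θ m l := by
  have h := hl i
  cases hw : iter θ k₀ i with
  | nil => simp [hw] at h
  | cons b w =>
    obtain rfl : b = l := by simpa [hw] using h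
    obtain ⟨y, -, n, h1, h2, h3⟩ := base_subset_base hθ hx (u := []) (by simpa using hw)
    have := (h1 0).2
    simpa [h2, h3] using this

/-- At high levels the points of a base agree around the origin, and the points of the same floor
agree around the origin. -/
theorem exists_level_agree (hθ : IsPrimitive θ) (hp : IsProper θ) (N : ℕ) :
    ∃ k₀, ∀ k ≥ k₀,
      (∀ x ∈ ⋃ i, base θ k i, ∀ x' ∈ ⋃ i, base θ k i, ∀ t : ℤ, -N ≤ t → t ≤ N → x.1 t = x'.1 t) ∧
      (∀ i j, j < height θ k i → ∀ x ∈ floor θ k i j, ∀ x' ∈ floor θ k i j,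
        ∀ t : ℤ, -N ≤ t → t ≤ N → x.1 t = x'.1 t) := by
  obtain ⟨l, r, k₁, hlr⟩ := hp
  obtain ⟨m₀, hm₀⟩ := Filter.eventually_atTop.1
    (((hθ.length_tendsto l).eventually_ge_atTop (N + 1)).and
      ((hθ.length_tendsto r).eventually_ge_atTop (N + 1)))
  refine ⟨m₀ + k₁, fun k hk => ?_⟩
  -- All words `θ^(m+k₁)(a)` begin with `θ^m(l)` and end with `θ^m(r)`, which fixes a long future
  -- and past of every base point.
  obtain ⟨m, rfl⟩ := Nat.exists_eq_add_of_le' (show k₁ ≤ k by omega)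
  obtain ⟨hP, hP'⟩ := hm₀ m (by omega)
  have hneg : ∀ {i i' : A} {x x' : subshift θ}, x ∈ base θ (m + k₁) i → x' ∈ base θ (m + k₁) i' →
      ∀ t : ℤ, -N ≤ t → t < 0 → x.1 t = x'.1 t := by
    intro i i' x x' hx hx' t h1 h2
    have e := (word_suffix_of_mem_base (fun a => (hlr a).2) hx).trans
      (word_suffix_of_mem_base (fun a => (hlr a).2) hx').symm
    have := (word_eq_word_iff _ _ _ _ _).1 e (t + (iter θ m r).length).toNat (by omega)
    rwa [show -((iter θ m r).length : ℤ) + ((t + (iter θ m r).length).toNat : ℤ) = t by omega]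
      at this
  have hpos : ∀ {i i' : A} {x x' : subshift θ}, x ∈ base θ (m + k₁) i → x' ∈ base θ (m + k₁) i' →
      ∀ t : ℤ, 0 ≤ t → t ≤ N → x.1 t = x'.1 t := by
    intro i i' x x' hx hx' t h1 h2
    have e := (word_prefix_of_mem_base hθ (fun a => (hlr a).1) hx).trans
      (word_prefix_of_mem_base hθ (fun a => (hlr a).1) hx').symm
    have := (word_eq_word_iff _ _ _ _ _).1 e t.toNat (by omega)
    rwa [show 0 + (t.toNat : ℤ) = t by omega] at this
  constructor
  · intro x hx x' hx' t h1 h2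
    obtain ⟨i, hi⟩ := Set.mem_iUnion.1 hx
    obtain ⟨i', hi'⟩ := Set.mem_iUnion.1 hx'
    rcases lt_or_ge t 0 with h | h
    · exact hneg hi hi' t h1 h
    · exact hpos hi hi' t h h2
  · rintro i j hj x ⟨b, hb, rfl⟩ x' ⟨b', hb', rfl⟩ t h1 h2
    rw [shift_iterate_apply, shift_iterate_apply]
    rcases lt_or_ge (t + j) 0 with h | h
    · exact hneg hb hb' _ (by omega) h
    rcases lt_or_ge (t + j) (height θ (m + k₁) i) with h' | h'
    · have e := (word_of_mem_base hb).trans (word_of_mem_base hb').symm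
      have := (word_eq_word_iff _ _ _ _ _).1 e (t + j).toNat (by omega)
      rwa [show 0 + ((t + j).toNat : ℤ) = t + j by omega] at this
    · obtain ⟨c, hc⟩ := exists_shift_height_mem_base hb
      obtain ⟨c', hc'⟩ := exists_shift_height_mem_base hb'
      have := hpos hc hc' (t + j - height θ (m + k₁) i) (by omega) (by omega)
      simpa using this

theorem shift_iterate_injective (haper : IsAperiodic θ) (x : subshift θ) :
    Function.Injective fun n => (Speedup.shift θ)^[n] x := by
  have key : ∀ a d : ℕ, (Speedup.shift θ)^[a + d] x = (Speedup.shift θ)^[a] x → d = 0 := by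
    intro a d h
    by_contra hd
    rw [add_comm, Function.iterate_add_apply] at h
    exact haper _ d (Nat.pos_of_ne_zero hd) h
  intro a b hab
  rcases le_total a b with h | h <;> obtain ⟨d, rfl⟩ := Nat.exists_eq_add_of_le h
  · rw [key a d hab.symm, add_zero]
  · rw [key b d hab, add_zero]

variable {S : subshift θ ≃ₜ subshift θ} {p : subshift θ → ℕ}

theorem IsBoundedSpeedup.le_maxJump {X : Type*} [TopologicalSpace X] {T S : X ≃ₜ X} {p : X → ℕ}
    (hS : IsBoundedSpeedup T S p) (x : X) : p x ≤ maxJump p := by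
  obtain ⟨M, hM⟩ := hS.bounded
  exact le_csSup ⟨M, by rintro _ ⟨y, rfl⟩; exact hM y⟩ ⟨x, rfl⟩

theorem jump_eq_iff (haper : IsAperiodic θ) (hS : IsBoundedSpeedup (Speedup.shift θ) S p)
    (x : subshift θ) (k : ℕ) : p x = k ↔ S x = (Speedup.shift θ)^[k] x := by
  constructor
  · rintro rfl
    exact hS.eq_iterate x
  · intro h
    rw [hS.eq_iterate] at h
    exact shift_iterate_injective haper x h

/-- Without periodic points, `p x = k` is the closed condition `S x = T^k x`; finitely many closed
level sets that partition a space are open. -/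
theorem continuous_jump [DiscreteTopology A] (haper : IsAperiodic θ)
    (hS : IsBoundedSpeedup (Speedup.shift θ) S p) : Continuous p := by
  have hclosed : ∀ k, IsClosed (p ⁻¹' {k}) := by
    intro k
    have : p ⁻¹' {k} = {x | S x = (Speedup.shift θ)^[k] x} := by
      ext x
      exact jump_eq_iff haper hS x k
    rw [this]
    exact isClosed_eq S.continuous ((Speedup.shift θ).continuous.iterate k)
  rw [continuous_discrete_rng]
  intro k
  have : p ⁻¹' {k} = (⋃ m ∈ (Finset.range (maxJump p + 1)).erase k, p ⁻¹' {m})ᶜ := by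
    ext x
    have := hS.le_maxJump x
    simp only [Set.mem_preimage, Set.mem_singleton_iff, Finset.mem_erase, Finset.mem_range,
      Set.mem_compl_iff, Set.mem_iUnion, not_exists]
    constructor
    · rintro rfl m ⟨h1, -⟩ h2
      exact h1 h2.symm
    · intro h
      by_contra hne
      exact h (p x) ⟨hne, by omega⟩ rfl
  rw [this]
  exact (isClosed_biUnion_finset fun m _ => hclosed m).isOpen_compl

theorem exists_agree_imp_jump_eq [Finite A] [DiscreteTopology A] (haper : IsAperiodic θ)
    (hS : IsBoundedSpeedup (Speedup.shift θ) S p) :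
    ∃ N : ℕ, ∀ x x' : subshift θ, (∀ t : ℤ, -N ≤ t → t ≤ N → x.1 t = x'.1 t) → p x = p x' := by
  have := compactSpace_subshift θ
  have hc := continuous_jump haper hS
  have hloc : ∀ x : subshift θ, ∃ N : ℕ, ∀ x' : subshift θ,
      (∀ t : ℤ, -N ≤ t → t ≤ N → x.1 t = x'.1 t) → p x' = p x := by
    intro x
    exact exists_agree_of_isOpen ((isOpen_discrete {p x}).preimage hc) (x := x) rfl
  choose N hN using hloc
  obtain ⟨I, -, hI⟩ := isCompact_univ.elim_nhds_subcover
    (fun x => {x' : subshift θ | ∀ t : ℤ, -N x ≤ t → t ≤ N x → x.1 t = x'.1 t})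
    fun x _ => setOf_agree_mem_nhds x (N x)
  refine ⟨I.sup N, fun x x' h => ?_⟩
  obtain ⟨z, hz, hxz⟩ := Set.mem_iUnion₂.1 (hI (Set.mem_univ x))
  have hle : N z ≤ I.sup N := Finset.le_sup hz
  rw [hN z x hxz, hN z x' fun t h1 h2 => (hxz t h1 h2).trans (h t (by omega) (by omega))]

theorem exists_isLarge [Finite A] [DiscreteTopology A] (hθ : IsPrimitive θ) (hp : IsProper θ)
    (haper : IsAperiodic θ) (hS : IsBoundedSpeedup (Speedup.shift θ) S p) :
    ∃ k₀, ∀ k ≥ k₀, IsLarge θ p k := by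
  obtain ⟨N, hN⟩ := exists_agree_imp_jump_eq haper hS
  -- The third condition compares points shifted by up to `maxJump p`, so the agreement around the
  -- origin needs this margin.
  obtain ⟨k₁, hk₁⟩ := exists_level_agree hθ hp (N + maxJump p)
  have htall : ∀ᶠ k in Filter.atTop, ∀ i, maxJump p + 1 ≤ (iter θ k i).length :=
    Filter.eventually_all.2 fun i => (hθ.length_tendsto i).eventually_ge_atTop _
  obtain ⟨k₂, hk₂⟩ := Filter.eventually_atTop.1 htall
  refine ⟨k₁ + k₂, fun k hk => ⟨?_, fun i => hk₂ k (by omega) i, ?_⟩⟩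
  · intro i j hj x hx y hy
    exact hN x y fun t h1 h2 =>
      (hk₁ k (by omega)).2 i j hj x hx y hy t (by push_cast; omega) (by push_cast; omega)
  · rintro n hn _ ⟨x, hx, rfl⟩ _ ⟨y, hy, rfl⟩
    refine hN _ _ fun t h1 h2 => ?_
    rw [shift_iterate_apply, shift_iterate_apply]
    exact (hk₁ k (by omega)).1 x hx y hy _ (by push_cast; omega) (by push_cast; omega)

theorem base_add_subset (hθ : IsPrimitive θ) {k m : ℕ} {i : A} {x : subshift θ}
    (hx : x ∈ base θ (k + m) i) : ∃ b ∈ iter θ m i, x ∈ base θ k b := by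
  obtain ⟨b, v, hv⟩ := List.exists_cons_of_ne_nil (hθ.iter_ne_nil m i)
  exact ⟨b, by simp [hv], base_subset_base hθ hx (u := []) (by simpa using hv)⟩

/-- Each floor of level `k + m` lies in a floor of level `k`, each base in a base, and columns do
not get shorter than the lowest one stacked in them. -/
theorem IsLarge.add (hθ : IsPrimitive θ) {k : ℕ} (hk : IsLarge θ p k) (m : ℕ) :
    IsLarge θ p (k + m) := by
  refine ⟨?_, ?_, ?_⟩
  · intro i j hj
    rw [height, iter_add] at hj
    obtain ⟨u, b, v, hi, h1, h2⟩ := exists_split hj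
    have key : ∀ x ∈ floor θ (k + m) i j,
        x ∈ floor θ k b (j - (u.flatMap (iter θ k)).length) := by
      rintro _ ⟨x, hx, rfl⟩
      refine ⟨_, base_subset_base hθ hx hi, ?_⟩
      rw [← Function.iterate_add_apply, Nat.sub_add_cancel h1]
    intro x hx y hy
    exact hk.jump_const b _ (by rw [height]; omega) x (key x hx) y (key y hy)
  · intro i
    obtain ⟨b, v, hv⟩ := List.exists_cons_of_ne_nil (hθ.iter_ne_nil m i)
    refine (hk.tall b).trans_le ?_
    rw [height, height, iter_add]
    exact (infix_flatMap_of_mem (iter θ k) (by simp [hv])).length_le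
  · rintro n hn _ ⟨x, hx, rfl⟩ _ ⟨y, hy, rfl⟩
    have key : ∀ z ∈ ⋃ i, base θ (k + m) i, z ∈ ⋃ i, base θ k i := by
      intro z hz
      obtain ⟨i, hi⟩ := Set.mem_iUnion.1 hz
      obtain ⟨b, -, hb⟩ := base_add_subset hθ hi
      exact Set.mem_iUnion.2 ⟨b, hb⟩
    exact hk.low_floors n hn _ ⟨x, key x hx, rfl⟩ _ ⟨y, key y hy, rfl⟩

end Large

/-! ### The speedup as an injection of positions, and its entries -/

section JumpPositions

variable {A : Type*} [TopologicalSpace A] {θ : A → List A}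

/-- In the coordinate `n` of the forward orbit `T^n x`, the map `S` is `n ↦ n + p(T^n x)`. -/
def jumpPos (p : subshift θ → ℕ) (x : subshift θ) (n : ℕ) : ℕ := n + p ((Speedup.shift θ)^[n] x)

/-- The positions at which the `S`-paths enter the forward orbit of `x`. -/
def entries (p : subshift θ → ℕ) (x : subshift θ) : Set ℕ := {e | ∀ n, jumpPos p x n ≠ e}

variable {S : subshift θ ≃ₜ subshift θ} {p : subshift θ → ℕ}

theorem speedup_iterate (hS : IsBoundedSpeedup (Speedup.shift θ) S p) (x : subshift θ) (m n : ℕ) :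
    S^[m] ((Speedup.shift θ)^[n] x) = (Speedup.shift θ)^[(jumpPos p x)^[m] n] x := by
  induction m generalizing n with
  | zero => rfl
  | succ m ih =>
    rw [Function.iterate_succ_apply, hS.eq_iterate, ← Function.iterate_add_apply, add_comm, ih,
      Function.iterate_succ_apply]
    rfl

theorem add_sum_jump (hS : IsBoundedSpeedup (Speedup.shift θ) S p) (x : subshift θ) (m n : ℕ) :
    n + ∑ r ∈ Finset.range m, p (S^[r] ((Speedup.shift θ)^[n] x)) = (jumpPos p x)^[m] n := by
  induction m with
  | zero => simp
  | succ m ih =>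
    rw [Finset.sum_range_succ, ← add_assoc, ih, speedup_iterate hS, Function.iterate_succ_apply']
    rfl

theorem jumpPos_injective (haper : IsAperiodic θ) (hS : IsBoundedSpeedup (Speedup.shift θ) S p)
    (x : subshift θ) : Function.Injective (jumpPos p x) := by
  intro a b hab
  have h1 := speedup_iterate hS x 1 a
  have h2 := speedup_iterate hS x 1 b
  simp only [Function.iterate_one] at h1 h2
  rw [hab, ← h2] at h1
  exact shift_iterate_injective haper x (S.injective h1)

theorem lt_jumpPos (hS : IsBoundedSpeedup (Speedup.shift θ) S p) (x : subshift θ) (n : ℕ) :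
    n < jumpPos p x n := Nat.lt_add_of_pos_right (hS.pos _)

theorem jumpPos_le (hS : IsBoundedSpeedup (Speedup.shift θ) S p) (x : subshift θ) (n : ℕ) :
    jumpPos p x n ≤ n + maxJump p := Nat.add_le_add_left (hS.le_maxJump _) _

theorem add_le_iterate_jumpPos (hS : IsBoundedSpeedup (Speedup.shift θ) S p) (x : subshift θ)
    (m n : ℕ) : n + m ≤ (jumpPos p x)^[m] n := by
  induction m with
  | zero => rfl
  | succ m ih =>
    rw [Function.iterate_succ_apply']
    have := lt_jumpPos hS x ((jumpPos p x)^[m] n)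
    omega

theorem iterate_jumpPos_le (hS : IsBoundedSpeedup (Speedup.shift θ) S p) (x : subshift θ)
    (m n : ℕ) : (jumpPos p x)^[m] n ≤ n + m * maxJump p := by
  induction m with
  | zero => simp
  | succ m ih =>
    rw [Function.iterate_succ_apply', add_mul]
    have := jumpPos_le hS x ((jumpPos p x)^[m] n)
    omega

theorem iterate_jumpPos_shift (p : subshift θ → ℕ) (x : subshift θ) (a m n : ℕ) :
    (jumpPos p ((Speedup.shift θ)^[a] x))^[m] n + a = (jumpPos p x)^[m] (n + a) := by
  induction m with
  | zero => rfl
  | succ m ih =>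
    rw [Function.iterate_succ_apply', Function.iterate_succ_apply', ← ih, jumpPos, jumpPos,
      Function.iterate_add_apply]
    omega

/-- From `maxJump p` on, the `S`-preimage of `T^e x` still lies on the forward orbit of `x`. -/
theorem entries_lt (hS : IsBoundedSpeedup (Speedup.shift θ) S p) {x : subshift θ} {e : ℕ}
    (he : e ∈ entries p x) : e < maxJump p := by
  by_contra hcon
  set y := S.symm ((Speedup.shift θ)^[e] x) with hy
  have h1 : (Speedup.shift θ)^[p y] y = (Speedup.shift θ)^[e] x := by
    rw [← hS.eq_iterate, hy, Homeomorph.apply_symm_apply]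
  have h2 := hS.le_maxJump y
  have h3 : y = (Speedup.shift θ)^[e - p y] x := by
    apply ((Speedup.shift θ).injective.iterate (p y))
    rw [h1, ← Function.iterate_add_apply]
    congr 1
    omega
  refine he (e - p y) ?_
  rw [jumpPos, ← h3]
  omega

theorem exists_entry (hS : IsBoundedSpeedup (Speedup.shift θ) S p) (x : subshift θ) (n : ℕ) :
    ∃ e ∈ entries p x, ∃ m, (jumpPos p x)^[m] e = n := by
  induction n using Nat.strong_induction_on with
  | _ n ih =>
    by_cases hn : n ∈ entries p x
    · exact ⟨n, hn, 0, rfl⟩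
    · simp only [entries, Set.mem_ofPred_eq, not_forall, not_not] at hn
      obtain ⟨n', rfl⟩ := hn
      obtain ⟨e, he, m, rfl⟩ := ih n' (lt_jumpPos hS x n')
      exact ⟨e, he, m + 1, Function.iterate_succ_apply' _ _ _⟩

/-- Paths of an injection never merge, and an entry has no predecessor. -/
theorem entry_unique (haper : IsAperiodic θ) (hS : IsBoundedSpeedup (Speedup.shift θ) S p)
    {x : subshift θ} {e e' : ℕ} (he : e ∈ entries p x) (he' : e' ∈ entries p x) {m m' : ℕ}
    (h : (jumpPos p x)^[m] e = (jumpPos p x)^[m'] e') : e = e' := by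
  have hinj := jumpPos_injective haper hS x
  have key : ∀ {e e' : ℕ}, e ∈ entries p x → ∀ (m d : ℕ),
      (jumpPos p x)^[m] e = (jumpPos p x)^[m + d] e' → e = e' := by
    intro e e' he m d h
    rw [Function.iterate_add_apply] at h
    have h' := hinj.iterate m h
    cases d with
    | zero => exact h'
    | succ d =>
      rw [Function.iterate_succ_apply'] at h'
      exact absurd h'.symm (he _)
  rcases le_total m m' with hm | hm <;> obtain ⟨d, rfl⟩ := Nat.exists_eq_add_of_le hm
  · exact key he m d h
  · exact (key he' m' d h.symm).symm

/-- Entries lie below `maxJump p` and jumps go upwards, so only the jumps from these low positions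
decide which positions are entries. -/
theorem entries_congr (hS : IsBoundedSpeedup (Speedup.shift θ) S p) {x x' : subshift θ}
    (h : ∀ n ≤ maxJump p, p ((Speedup.shift θ)^[n] x) = p ((Speedup.shift θ)^[n] x')) :
    entries p x = entries p x' := by
  have key : ∀ {x x' : subshift θ},
      (∀ n ≤ maxJump p, p ((Speedup.shift θ)^[n] x) = p ((Speedup.shift θ)^[n] x')) →
      entries p x ⊆ entries p x' := by
    intro x x' h e he n hn
    have h1 := entries_lt hS he
    have h2 := lt_jumpPos hS x' n
    refine he n ?_
    rw [← hn, jumpPos, jumpPos, h n (by omega)]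
  exact Set.Subset.antisymm (key h) (key fun n hn => (h n hn).symm)

theorem IsLarge.entries_eq (hS : IsBoundedSpeedup (Speedup.shift θ) S p) {k : ℕ}
    (hk : IsLarge θ p k) {x x' : subshift θ} (hx : x ∈ ⋃ i, base θ k i)
    (hx' : x' ∈ ⋃ i, base θ k i) : entries p x = entries p x' :=
  entries_congr hS fun n hn => hk.low_floors n hn _ ⟨x, hx, rfl⟩ _ ⟨x', hx', rfl⟩

theorem zero_mem_entries (hS : IsBoundedSpeedup (Speedup.shift θ) S p) (x : subshift θ) :
    0 ∈ entries p x := fun n h => by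
  have := lt_jumpPos hS x n
  omega

end JumpPositions

/-! ### Orbits -/

section Orbits

variable {X : Type*} [TopologicalSpace X]

theorem zpow_natCast_apply (f : X ≃ₜ X) (n : ℕ) (x : X) : (f ^ (n : ℤ)) x = f^[n] x := by
  rw [zpow_natCast]
  induction n generalizing x with
  | zero => rfl
  | succ n ih => rw [pow_succ, Function.iterate_succ_apply, ← ih]; rfl

theorem mem_orbit_self (f : X ≃ₜ X) (x : X) : x ∈ orbit f x := ⟨0, rfl⟩

theorem orbit_eq_of_mem {f : X ≃ₜ X} {x y : X} (h : y ∈ orbit f x) : orbit f y = orbit f x := by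
  obtain ⟨j, rfl⟩ := h
  ext z
  constructor
  · rintro ⟨i, rfl⟩
    exact ⟨i + j, by simp only [zpow_add]; rfl⟩
  · rintro ⟨i, rfl⟩
    refine ⟨i - j, ?_⟩
    show ((f ^ (i - j)) * f ^ j) x = _
    rw [← zpow_add, sub_add_cancel]

theorem iterate_mem_orbit (f : X ≃ₜ X) (x : X) (n : ℕ) : f^[n] x ∈ orbit f x :=
  ⟨n, zpow_natCast_apply f n x⟩

theorem orbit_iterate (f : X ≃ₜ X) (x : X) (n : ℕ) : orbit f (f^[n] x) = orbit f x :=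
  orbit_eq_of_mem (iterate_mem_orbit f x n)

theorem IsBoundedSpeedup.orbit_subset {T S : X ≃ₜ X} {p : X → ℕ} (hS : IsBoundedSpeedup T S p)
    (x : X) : orbit S x ⊆ orbit T x := by
  have hone : ∀ y, orbit T (S y) = orbit T y := fun y => by
    rw [hS.eq_iterate, orbit_iterate]
  rintro _ ⟨j, rfl⟩
  suffices h : orbit T ((S ^ j) x) = orbit T x by
    rw [← h]; exact mem_orbit_self _ _
  induction j using Int.induction_on with
  | zero => rfl
  | succ j ih =>
    have : (S ^ ((j : ℤ) + 1)) x = S ((S ^ (j : ℤ)) x) := by rw [add_comm, zpow_add, zpow_one]; rfl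
    rw [this, hone, ih]
  | pred j ih =>
    have : S ((S ^ (-(j : ℤ) - 1)) x) = (S ^ (-(j : ℤ))) x := by
      show (S * S ^ (-(j : ℤ) - 1)) x = _
      rw [← zpow_one_add]
      congr 2
      ring
    rw [← hone, this, ih]

variable {A : Type*} [TopologicalSpace A] {θ : A → List A}
  {S : subshift θ ≃ₜ subshift θ} {p : subshift θ → ℕ}

theorem encard_orbits (haper : IsAperiodic θ) (hS : IsBoundedSpeedup (Speedup.shift θ) S p)
    (x : subshift θ) :
    {O : Set (subshift θ) | (∃ y, O = orbit S y) ∧ O ⊆ orbit (Speedup.shift θ) x}.encard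
      = (entries p x).encard := by
  have hinj : Set.InjOn (fun e => orbit S ((Speedup.shift θ)^[e] x)) (entries p x) := by
    have key : ∀ {e e' : ℕ}, e ∈ entries p x → e' ∈ entries p x → ∀ j : ℕ,
        S^[j] ((Speedup.shift θ)^[e] x) = (Speedup.shift θ)^[e'] x → e = e' := by
      intro e e' he he' j hj
      rw [speedup_iterate hS] at hj
      exact entry_unique haper hS he he' (m := j) (m' := 0) (shift_iterate_injective haper x hj)
    intro e he e' he' h
    have hmem : (Speedup.shift θ)^[e'] x ∈ orbit S ((Speedup.shift θ)^[e] x) := by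
      simp only at h
      rw [h]; exact mem_orbit_self _ _
    obtain ⟨j, hj⟩ := hmem
    rcases le_total 0 j with h0 | h0
    · obtain ⟨j, rfl⟩ := Int.eq_ofNat_of_zero_le h0
      exact key he he' j (by rw [← zpow_natCast_apply]; exact hj)
    · obtain ⟨i, hi⟩ := Int.eq_ofNat_of_zero_le (neg_nonneg.2 h0)
      refine (key he' he i ?_).symm
      rw [← hj, ← zpow_natCast_apply]
      show (S ^ (i : ℤ) * S ^ j) _ = _
      rw [← zpow_add, ← hi, neg_add_cancel, zpow_zero]
      rfl
  rw [← hinj.encard_image]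
  congr 1
  ext O
  constructor
  · rintro ⟨⟨y, rfl⟩, hO⟩
    -- If `y` lies `i` steps behind `x`, then `S^i` moves it forward by at least `i`, onto the
    -- forward orbit of `x`.
    obtain ⟨b, a, hb⟩ : ∃ b a : ℕ, S^[a] y = (Speedup.shift θ)^[b] x := by
      obtain ⟨j, hj⟩ := hO (mem_orbit_self S y)
      rcases le_total 0 j with h0 | h0
      · obtain ⟨j, rfl⟩ := Int.eq_ofNat_of_zero_le h0
        exact ⟨j, 0, hj.symm.trans (zpow_natCast_apply _ _ _)⟩
      · obtain ⟨i, hi⟩ := Int.eq_ofNat_of_zero_le (neg_nonneg.2 h0)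
        have hx : (Speedup.shift θ)^[i] y = x := by
          rw [← hj, ← zpow_natCast_apply]
          show (Speedup.shift θ ^ (i : ℤ) * Speedup.shift θ ^ j) _ = _
          rw [← zpow_add, ← hi, neg_add_cancel, zpow_zero]
          rfl
        have h1 := speedup_iterate hS y i 0
        have h2 := add_le_iterate_jumpPos hS y i 0
        refine ⟨(jumpPos p y)^[i] 0 - i, i, ?_⟩
        rw [← hx, ← Function.iterate_add_apply, Nat.sub_add_cancel (by omega), ← h1]
        rfl
    obtain ⟨e, he, m, rfl⟩ := exists_entry hS x b
    refine ⟨e, he, ?_⟩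
    show orbit S _ = orbit S y
    rw [← orbit_iterate S y a, hb, ← speedup_iterate hS, orbit_iterate]
  · rintro ⟨e, -, rfl⟩
    refine ⟨⟨_, rfl⟩, ?_⟩
    rw [← orbit_iterate (Speedup.shift θ) x e]
    exact hS.orbit_subset _

theorem IsLarge.isOrbitNumber_iff [Finite A] [DiscreteTopology A] (hθ : IsPrimitive θ)
    (hp : IsProper θ) (haper : IsAperiodic θ) (hS : IsBoundedSpeedup (Speedup.shift θ) S p) {k : ℕ}
    (hk : IsLarge θ p k) {b : subshift θ} (hb : b ∈ ⋃ i, base θ k i) (c : ℕ) :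
    IsOrbitNumber (Speedup.shift θ) S c ↔ (entries p b).encard = c := by
  constructor
  · intro h
    rw [← encard_orbits haper hS]
    exact h b
  · intro h x
    obtain ⟨i, j, -, b', hb', rfl⟩ := exists_mem_floor hθ hp k x
    rw [orbit_iterate, encard_orbits haper hS, ← h,
      hk.entries_eq hS hb (Set.mem_iUnion.2 ⟨i, hb'⟩)]

end Orbits

/-! ### Labels -/

section Labels

variable {A : Type*} [TopologicalSpace A] {θ : A → List A}
  {S : subshift θ ≃ₜ subshift θ} {p : subshift θ → ℕ} {c : ℕ} {e : Fin c → ℕ} {k : ℕ}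

/-- `e` lists, in increasing order, the heights at which `S`-paths enter the columns of level
`k`. -/
structure IsEntryList (θ : A → List A) (p : subshift θ → ℕ) (k : ℕ) (e : Fin c → ℕ) : Prop where
  strictMono : StrictMono e
  range_eq : ∀ x ∈ ⋃ i, base θ k i, Set.range e = entries p x

theorem IsLarge.exists_isEntryList (hS : IsBoundedSpeedup (Speedup.shift θ) S p)
    (hk : IsLarge θ p k) {b : subshift θ} (hb : b ∈ ⋃ i, base θ k i)
    (hc : (entries p b).encard = c) : ∃ e : Fin c → ℕ, IsEntryList θ p k e := by
  have hfin : (entries p b).Finite := Set.finite_of_encard_eq_coe hc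
  have hcard : hfin.toFinset.card = c := by
    rw [hfin.encard_eq_coe_toFinset_card] at hc
    exact_mod_cast hc
  refine ⟨hfin.toFinset.orderEmbOfFin hcard, (hfin.toFinset.orderEmbOfFin hcard).strictMono,
    fun x hx => ?_⟩
  rw [hk.entries_eq hS hx hb]
  simp

theorem IsEntryList.mem (he : IsEntryList θ p k e) {i : A} {x : subshift θ} (hx : x ∈ base θ k i)
    (q : Fin c) : e q ∈ entries p x := by
  rw [← he.range_eq x (Set.mem_iUnion.2 ⟨i, hx⟩)]
  exact ⟨q, rfl⟩

theorem IsEntryList.exists_eq (he : IsEntryList θ p k e) {i : A} {x : subshift θ}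
    (hx : x ∈ base θ k i) {r : ℕ} (hr : r ∈ entries p x) : ∃ q, e q = r := by
  rwa [← he.range_eq x (Set.mem_iUnion.2 ⟨i, hx⟩)] at hr

theorem IsEntryList.add (hθ : IsPrimitive θ) (he : IsEntryList θ p k e) (m : ℕ) :
    IsEntryList θ p (k + m) e := by
  refine ⟨he.strictMono, fun x hx => ?_⟩
  obtain ⟨i, hi⟩ := Set.mem_iUnion.1 hx
  obtain ⟨b, -, hb⟩ := base_add_subset hθ hi
  exact he.range_eq x (Set.mem_iUnion.2 ⟨b, hb⟩)

theorem IsLarge.jumpPos_eq (hk : IsLarge θ p k) {i : A} {x x' : subshift θ} (hx : x ∈ base θ k i)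
    (hx' : x' ∈ base θ k i) {n : ℕ} (hn : n < height θ k i) : jumpPos p x n = jumpPos p x' n := by
  rw [jumpPos, jumpPos, hk.jump_const i n hn _ ⟨x, hx, rfl⟩ _ ⟨x', hx', rfl⟩]

theorem IsLarge.iterate_jumpPos_eq (hS : IsBoundedSpeedup (Speedup.shift θ) S p)
    (hk : IsLarge θ p k) {i : A} {x x' : subshift θ} (hx : x ∈ base θ k i)
    (hx' : x' ∈ base θ k i) {s : ℕ} (m : ℕ) (hm : (jumpPos p x)^[m] s < height θ k i) :
    (jumpPos p x)^[m] s = (jumpPos p x')^[m] s := by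
  induction m with
  | zero => rfl
  | succ m ih =>
    rw [Function.iterate_succ_apply'] at hm
    have h1 := lt_jumpPos hS x ((jumpPos p x)^[m] s)
    rw [Function.iterate_succ_apply', Function.iterate_succ_apply', ← ih (by omega),
      hk.jumpPos_eq hx hx' (by omega)]

theorem IsLarge.climbs_iff (hS : IsBoundedSpeedup (Speedup.shift θ) S p) (hk : IsLarge θ p k)
    {i : A} {x : subshift θ} (hx : x ∈ base θ k i) {s j : ℕ} (hj : j < height θ k i) :
    Climbs θ S p k i s j ↔ ∃ m, (jumpPos p x)^[m] s = j := by
  constructor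
  · rintro ⟨m, hm⟩
    exact ⟨m, by rw [← add_sum_jump hS]; exact hm _ ⟨x, hx, rfl⟩⟩
  · rintro ⟨m, rfl⟩
    refine ⟨m, ?_⟩
    rintro _ ⟨x', hx', rfl⟩
    rw [add_sum_jump hS, hk.iterate_jumpPos_eq hS hx hx' m hj]

/-- Each floor is on the path of exactly one entry and not below it. So once the paths of the first
`ℓ` entries are labelled, the lowest free floor is the next entry. -/
theorem IsLarge.hasLabel_iff (haper : IsAperiodic θ) (hS : IsBoundedSpeedup (Speedup.shift θ) S p)
    (hk : IsLarge θ p k) (he : IsEntryList θ p k e) {i : A} {x : subshift θ}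
    (hx : x ∈ base θ k i) (ℓ j : ℕ) :
    HasLabel θ S p k i ℓ j ↔
      j < height θ k i ∧ ∃ q : Fin c, (q : ℕ) = ℓ ∧ ∃ m, (jumpPos p x)^[m] (e q) = j := by
  induction ℓ using Nat.strong_induction_on generalizing j with
  | _ ℓ ih =>
    have hroot : ∀ t, ∃ q : Fin c, ∃ m, (jumpPos p x)^[m] (e q) = t := by
      intro t
      obtain ⟨r, hr, m, hm⟩ := exists_entry hS x t
      obtain ⟨q, rfl⟩ := he.exists_eq hx hr
      exact ⟨q, m, hm⟩
    have hU : ∀ t, (t < height θ k i ∧ ∀ m, ∀ _ : m < ℓ, ¬ HasLabel θ S p k i m t) ↔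
        t < height θ k i ∧ ∃ q : Fin c, ℓ ≤ q ∧ ∃ m, (jumpPos p x)^[m] (e q) = t := by
      intro t
      refine and_congr_right fun ht => ?_
      constructor
      · intro h
        obtain ⟨q, hq⟩ := hroot t
        refine ⟨q, not_lt.1 fun hlt => ?_, hq⟩
        exact h q hlt ((ih q hlt t).2 ⟨ht, q, rfl, hq⟩)
      · rintro ⟨q, hq, m, hm⟩ r hr hlab
        obtain ⟨-, q', rfl, m', hm'⟩ := (ih r hr t).1 hlab
        have := he.strictMono.injective
          (entry_unique haper hS (he.mem hx q) (he.mem hx q') (hm.trans hm'.symm))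
        subst this
        omega
    have hlow : ∀ q, e q < height θ k i := fun q =>
      (entries_lt hS (he.mem hx q)).trans (hk.tall i)
    have hleast : ∀ s, IsLeast {t : ℕ | t < height θ k i ∧
        ∀ m, ∀ _ : m < ℓ, ¬ HasLabel θ S p k i m t} s ↔ ∃ q : Fin c, (q : ℕ) = ℓ ∧ e q = s := by
      have hset : {t : ℕ | t < height θ k i ∧ ∀ m, ∀ _ : m < ℓ, ¬ HasLabel θ S p k i m t}
          = {t | t < height θ k i ∧ ∃ q : Fin c, ℓ ≤ q ∧ ∃ m, (jumpPos p x)^[m] (e q) = t} := by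
        ext t; exact hU t
      have hq : ∀ q : Fin c, (q : ℕ) = ℓ → IsLeast {t | t < height θ k i ∧
          ∃ q : Fin c, ℓ ≤ q ∧ ∃ m, (jumpPos p x)^[m] (e q) = t} (e q) := by
        intro q hq
        refine ⟨⟨hlow q, q, hq.ge, 0, rfl⟩, ?_⟩
        rintro t ⟨-, q', hq', m, rfl⟩
        have h1 := add_le_iterate_jumpPos hS x m (e q')
        have h2 := he.strictMono.monotone (show q ≤ q' from Fin.le_def.2 (hq.trans_le hq'))
        omega
      intro s
      rw [hset]
      constructor
      · intro hs
        obtain ⟨-, q', hq', -⟩ := hs.1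
        exact ⟨⟨ℓ, by omega⟩, rfl, (hq ⟨ℓ, by omega⟩ rfl).unique hs⟩
      · rintro ⟨q, h1, rfl⟩
        exact hq q h1
    rw [HasLabel]
    simp only [hleast]
    constructor
    · rintro ⟨s, ⟨q, hq, rfl⟩, hj, hcl⟩
      exact ⟨hj, q, hq, (hk.climbs_iff hS hx hj).1 hcl⟩
    · rintro ⟨hj, q, hq, hcl⟩
      exact ⟨_, ⟨q, hq, rfl⟩, hj, (hk.climbs_iff hS hx hj).2 hcl⟩

/-- On the top floor with a given label, `S` moves to an entry of the next column. -/
theorem IsLarge.exists_jumpPos_top (haper : IsAperiodic θ)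
    (hS : IsBoundedSpeedup (Speedup.shift θ) S p)
    (hk : IsLarge θ p k) (he : IsEntryList θ p k e) {i : A} {x : subshift θ}
    (hx : x ∈ base θ k i) {ℓ : Fin c} {j : ℕ}
    (hj : IsGreatest {t : ℕ | HasLabel θ S p k i ℓ t} j) :
    j < height θ k i ∧ (∃ m, (jumpPos p x)^[m] (e ℓ) = j) ∧
      ∃ q, jumpPos p x j = height θ k i + e q := by
  obtain ⟨hjh, q, hq, m, hm⟩ := (hk.hasLabel_iff haper hS he hx ℓ j).1 hj.1
  obtain rfl : q = ℓ := Fin.ext hq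
  refine ⟨hjh, ⟨m, hm⟩, ?_⟩
  have hge : height θ k i ≤ jumpPos p x j := by
    by_contra hlt
    have hlab : HasLabel θ S p k i q (jumpPos p x j) :=
      (hk.hasLabel_iff haper hS he hx q _).2
        ⟨not_le.1 hlt, q, rfl, m + 1, by rw [Function.iterate_succ_apply', hm]⟩
    have := hj.2 hlab
    have := lt_jumpPos hS x j
    omega
  obtain ⟨i', hi'⟩ := exists_shift_height_mem_base hx
  -- By injectivity, the only predecessor of the landing position is `j`, which is still in the old
  -- column.
  have hent : jumpPos p x j - height θ k i ∈
      entries p ((Speedup.shift θ)^[height θ k i] x) := by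
    intro n hn
    have h1 := iterate_jumpPos_shift p x (height θ k i) 1 n
    simp only [Function.iterate_one] at h1
    have := jumpPos_injective haper hS x (a₁ := n + height θ k i) (a₂ := j) (by omega)
    omega
  obtain ⟨r, hr⟩ := he.exists_eq hi' hent
  exact ⟨r, by omega⟩

theorem IsLarge.exists_isGreatest (haper : IsAperiodic θ)
    (hS : IsBoundedSpeedup (Speedup.shift θ) S p)
    (hk : IsLarge θ p k) (he : IsEntryList θ p k e) {i : A} {x : subshift θ}
    (hx : x ∈ base θ k i) (ℓ : Fin c) : ∃ j, IsGreatest {t : ℕ | HasLabel θ S p k i ℓ t} j := by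
  have hb : BddAbove {t : ℕ | HasLabel θ S p k i ℓ t} :=
    ⟨height θ k i, fun t ht => ((hk.hasLabel_iff haper hS he hx ℓ t).1 ht).1.le⟩
  have hne : {t : ℕ | HasLabel θ S p k i ℓ t}.Nonempty :=
    ⟨e ℓ, (hk.hasLabel_iff haper hS he hx ℓ _).2
      ⟨(entries_lt hS (he.mem hx ℓ)).trans (hk.tall i), ℓ, rfl, 0, rfl⟩⟩
  exact ⟨_, Nat.sSup_mem hne hb, fun t ht => le_csSup hb ht⟩

/-- The `S`-path that enters column `i` of level `k` with label `ℓ` leaves it for the entry with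
label `π_i(ℓ)` of the next column. -/
def Transfers (θ : A → List A) (p : subshift θ → ℕ) (e : Fin c → ℕ) (k : ℕ)
    (π : A → Fin c → Fin c) : Prop :=
  ∀ i, ∀ x ∈ base θ k i, ∀ ℓ, ∃ m, (jumpPos p x)^[m] (e ℓ) = height θ k i + e (π i ℓ)

/-- An `S`-path enters a column only once. -/
theorem IsEntryList.target_unique (haper : IsAperiodic θ)
    (hS : IsBoundedSpeedup (Speedup.shift θ) S p)
    (he : IsEntryList θ p k e) {i : A} {x : subshift θ} {d : ℕ}
    (hx : (Speedup.shift θ)^[d] x ∈ base θ k i) {s m m' : ℕ} {q q' : Fin c}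
    (h : (jumpPos p x)^[m] s = d + e q) (h' : (jumpPos p x)^[m'] s = d + e q') : q = q' := by
  have key : ∀ {m r : ℕ} {q q' : Fin c}, (jumpPos p x)^[m] s = d + e q →
      (jumpPos p x)^[m + r] s = d + e q' → q = q' := by
    intro m r q q' h h'
    rw [add_comm m, Function.iterate_add_apply, h, add_comm d, ← iterate_jumpPos_shift,
      add_comm d] at h'
    exact he.strictMono.injective (entry_unique haper hS (he.mem hx q) (he.mem hx q')
      (m := r) (m' := 0) (Nat.add_right_cancel h'))
  rcases le_total m m' with hm | hm <;> obtain ⟨r, rfl⟩ := Nat.exists_eq_add_of_le hm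
  · exact key h h'
  · exact (key h' h).symm

theorem Transfers.unique [Finite A] [DiscreteTopology A] (hθ : IsPrimitive θ) (hp : IsProper θ)
    (haper : IsAperiodic θ) (hS : IsBoundedSpeedup (Speedup.shift θ) S p)
    (he : IsEntryList θ p k e) {π π' : A → Fin c → Fin c} (h : Transfers θ p e k π)
    (h' : Transfers θ p e k π') : π = π' := by
  ext i ℓ : 2
  obtain ⟨x, hx⟩ := base_nonempty hθ hp k i
  obtain ⟨m, hm⟩ := h i x hx ℓ
  obtain ⟨m', hm'⟩ := h' i x hx ℓ
  obtain ⟨i', hi'⟩ := exists_shift_height_mem_base hx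
  exact he.target_unique haper hS hi' hm hm'

theorem IsLarge.exists_transfers [Finite A] [DiscreteTopology A] (hθ : IsPrimitive θ)
    (hp : IsProper θ) (haper : IsAperiodic θ) (hS : IsBoundedSpeedup (Speedup.shift θ) S p)
    (hk : IsLarge θ p k) (he : IsEntryList θ p k e) : ∃ π, Transfers θ p e k π := by
  choose b hb using fun i => base_nonempty hθ hp k i
  choose j hj using fun i ℓ => hk.exists_isGreatest haper hS he (hb i) ℓ
  choose hjh _ π hπ using fun i ℓ => hk.exists_jumpPos_top haper hS he (hb i) (hj i ℓ)
  refine ⟨π, fun i x hx ℓ => ?_⟩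
  obtain ⟨-, ⟨m, hm⟩, -⟩ := hk.exists_jumpPos_top haper hS he hx (hj i ℓ)
  refine ⟨m + 1, ?_⟩
  rw [Function.iterate_succ_apply', hm, hk.jumpPos_eq hx (hb i) (hjh i ℓ), hπ]

/-- From the top floor of a label, `S` lands on an entry floor of the next column, and the label of
that floor is the index of the entry. -/
theorem IsLarge.isLabelMap_iff [Finite A] [DiscreteTopology A] (hθ : IsPrimitive θ)
    (hp : IsProper θ) (haper : IsAperiodic θ) (hS : IsBoundedSpeedup (Speedup.shift θ) S p)
    (hk : IsLarge θ p k) (he : IsEntryList θ p k e) (π : A → Fin c → Fin c) :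
    IsLabelMap θ S p k π ↔ Transfers θ p e k π := by
  have hlow : ∀ {i x}, x ∈ base θ k i → ∀ q, e q < height θ k i := fun hx q =>
    (entries_lt hS (he.mem hx q)).trans (hk.tall _)
  have hstep : ∀ {x : subshift θ} {i : A} {j : ℕ} {q : Fin c},
      jumpPos p x j = height θ k i + e q → S ((Speedup.shift θ)^[j] x)
        = (Speedup.shift θ)^[e q] ((Speedup.shift θ)^[height θ k i] x) := by
    intro x i j q h
    have := speedup_iterate hS x 1 j
    simp only [Function.iterate_one] at this
    rw [this, h, add_comm, Function.iterate_add_apply]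
  constructor
  · intro h i x hx ℓ
    obtain ⟨j, hj⟩ := hk.exists_isGreatest haper hS he hx ℓ
    obtain ⟨hjh, ⟨m, hm⟩, q, hq⟩ := hk.exists_jumpPos_top haper hS he hx hj
    obtain ⟨i', hi'⟩ := exists_shift_height_mem_base hx
    obtain ⟨a, t, hat, hlab⟩ := h i ℓ j hj _ ⟨x, hx, rfl⟩
    rw [hstep hq] at hat
    have ht : t < height θ k a := by
      obtain ⟨x', hx'⟩ := base_nonempty hθ hp k a
      exact ((hk.hasLabel_iff haper hS he hx' _ _).1 hlab).1
    obtain ⟨rfl, rfl⟩ := floor_unique hθ hp haper hat ht ⟨_, hi', rfl⟩ (hlow hi' q)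
    obtain ⟨-, q', hq', m', hm'⟩ := (hk.hasLabel_iff haper hS he hi' _ _).1 hlab
    obtain rfl : q' = π i ℓ := Fin.ext hq'
    have heq := entry_unique haper hS (he.mem hi' (π i ℓ)) (he.mem hi' q) (m := m') (m' := 0) hm'
    refine ⟨m + 1, ?_⟩
    rw [Function.iterate_succ_apply', hm, hq, heq]
  · rintro h i ℓ j hj _ ⟨x, hx, rfl⟩
    obtain ⟨hjh, ⟨m, hm⟩, q, hq⟩ := hk.exists_jumpPos_top haper hS he hx hj
    obtain ⟨i', hi'⟩ := exists_shift_height_mem_base hx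
    obtain ⟨m', hm'⟩ := h i x hx ℓ
    obtain rfl : q = π i ℓ := he.target_unique haper hS hi' (s := e ℓ) (m := m + 1)
      (by rw [Function.iterate_succ_apply', hm, hq]) hm'
    rw [hstep hq]
    exact ⟨i', _, ⟨_, hi', rfl⟩, (hk.hasLabel_iff haper hS he hi' _ _).2
      ⟨hlow hi' _, π i ℓ, rfl, 0, rfl⟩⟩

end Labels

/-! ### Labelled words and iterates of the symbol-label substitution -/

section LabelWords

variable {A C : Type*}

theorem labelWord_append (π : A → C → C) (ℓ : C) (u v : List A) :
    labelWord π ℓ (u ++ v) = labelWord π ℓ u ++ labelWord π (u.foldl (fun ℓ i => π i ℓ) ℓ) v := by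
  induction u generalizing ℓ with
  | nil => rfl
  | cons a u ih => simp [labelWord, ih]

theorem length_labelWord (π : A → C → C) (ℓ : C) (w : List A) :
    (labelWord π ℓ w).length = w.length := by
  induction w generalizing ℓ with
  | nil => rfl
  | cons a w ih => simp [labelWord, ih]

theorem mem_labelWord_iff {π : A → C → C} {ℓ : C} {w : List A} {q : A × C} :
    q ∈ labelWord π ℓ w ↔ ∃ u v, w = u ++ q.1 :: v ∧ u.foldl (fun ℓ i => π i ℓ) ℓ = q.2 := by
  constructor
  · intro h
    induction w generalizing ℓ with
    | nil => simp [labelWord] at h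
    | cons a w ih =>
      rcases List.mem_cons.1 h with rfl | h
      · exact ⟨[], w, rfl, rfl⟩
      · obtain ⟨u, v, rfl, h2⟩ := ih h
        exact ⟨a :: u, v, rfl, h2⟩
  · rintro ⟨u, v, rfl, h⟩
    rw [labelWord_append, h]
    simp [labelWord]

/-- If the labels are compatible with `θ^K`, the iterates of the symbol-label substitution are the
labelings of the iterates of `θ^K`. -/
theorem iter_symbolLabel {θ : A → List A} {K : ℕ} {π : A → C → C}
    (h : ∀ i ℓ, (iter θ K i).foldl (fun ℓ i => π i ℓ) ℓ = π i ℓ) (n : ℕ) (q : A × C) :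
    iter (symbolLabel θ K π) n q = labelWord π q.2 (iter θ (n * K) q.1) := by
  have hext : ∀ (ℓ : C) (w : List A), extend (symbolLabel θ K π) (labelWord π ℓ w)
      = labelWord π ℓ (w.flatMap (iter θ K)) := by
    intro ℓ w
    induction w generalizing ℓ with
    | nil => rfl
    | cons a w ih =>
      rw [List.flatMap_cons, labelWord_append, h, ← ih]
      rfl
  induction n with
  | zero => rw [zero_mul]; rfl
  | succ n ih =>
    rw [iter, Function.iterate_succ_apply', ← iter, ih, hext, ← iter_add]
    congr 2
    ring

end LabelWords

/-! ### Composition of label maps and existence of stable levels -/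

section Chains

variable {A : Type*} [TopologicalSpace A] {θ : A → List A}
  {S : subshift θ ≃ₜ subshift θ} {p : subshift θ → ℕ} {c : ℕ} {e : Fin c → ℕ} {k : ℕ}

/-- The `S`-path through consecutive columns of level `k`. -/
theorem Transfers.chain {π : A → Fin c → Fin c} (h : Transfers θ p e k π) {x : subshift θ}
    {w : List A} (hx : ∀ u b v, w = u ++ b :: v →
      (Speedup.shift θ)^[(u.flatMap (iter θ k)).length] x ∈ base θ k b) (ℓ : Fin c) :
    ∃ m, (jumpPos p x)^[m] (e ℓ)
      = (w.flatMap (iter θ k)).length + e (w.foldl (fun ℓ i => π i ℓ) ℓ) := by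
  induction w generalizing x ℓ with
  | nil => exact ⟨0, by simp⟩
  | cons a w ih =>
    obtain ⟨m, hm⟩ := h a x (hx [] a w rfl) ℓ
    obtain ⟨m', hm'⟩ := ih (x := (Speedup.shift θ)^[height θ k a] x) (by
      rintro u b v rfl
      have := hx (a :: u) b v rfl
      rw [List.flatMap_cons, List.length_append, add_comm, Function.iterate_add_apply] at this
      exact this) (π a ℓ)
    refine ⟨m' + m, ?_⟩
    rw [Function.iterate_add_apply, hm, add_comm (height θ k a), ← iterate_jumpPos_shift, hm',
      List.flatMap_cons, List.length_append, List.foldl_cons, height]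
    omega

theorem Transfers.chain_prefix (hθ : IsPrimitive θ) {π : A → Fin c → Fin c}
    (h : Transfers θ p e k π) {m : ℕ} {i : A} {x : subshift θ} (hx : x ∈ base θ (k + m) i)
    {u v : List A} (hi : iter θ m i = u ++ v) (ℓ : Fin c) :
    ∃ r, (jumpPos p x)^[r] (e ℓ)
      = (u.flatMap (iter θ k)).length + e (u.foldl (fun ℓ i => π i ℓ) ℓ) := by
  apply h.chain
  rintro s b t rfl
  exact base_subset_base hθ hx (v := t ++ v) (by simp [hi])

/-- Crossing a tall column means crossing the columns stacked in it one after the other. -/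
theorem Transfers.add (hθ : IsPrimitive θ) {π : A → Fin c → Fin c} (h : Transfers θ p e k π)
    (m : ℕ) :
    Transfers θ p e (k + m) fun i ℓ => (iter θ m i).foldl (fun ℓ i => π i ℓ) ℓ := by
  intro i x hx ℓ
  obtain ⟨r, hr⟩ := h.chain_prefix hθ hx (u := iter θ m i) (v := []) (by simp) ℓ
  exact ⟨r, by rw [hr, height, iter_add]⟩

theorem exists_isStableLevel [Finite A] [DiscreteTopology A] (hθ : IsPrimitive θ)
    (hp : IsProper θ) (haper : IsAperiodic θ) (hS : IsBoundedSpeedup (Speedup.shift θ) S p)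
    (hk : IsLarge θ p k) (he : IsEntryList θ p k e) :
    ∃ (K : ℕ) (π : A → Fin c → Fin c), IsStableLevel θ S p K π := by
  have hl := fun m => hk.add hθ m
  have hel := fun m => he.add hθ m
  choose g hg using fun m => (hl m).exists_transfers hθ hp haper hS (hel m)
  -- Each label map determines the next one, so a single repetition in the finite set of maps makes
  -- the sequence periodic from there on.
  have hsucc : ∀ m, g (m + 1) = fun i ℓ => (iter θ 1 i).foldl (fun ℓ i => g m i ℓ) ℓ :=
    fun m => (hg (m + 1)).unique hθ hp haper hS (hel (m + 1)) ((hg m).add hθ 1)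
  obtain ⟨a, t, ht, hat⟩ : ∃ a t, 0 < t ∧ g (a + t) = g a := by
    obtain ⟨a, b, hne, hab⟩ := Finite.exists_ne_map_eq_of_infinite g
    rcases lt_or_gt_of_ne hne with h | h
    · exact ⟨a, b - a, by omega, by rw [Nat.add_sub_cancel' h.le, hab]⟩
    · exact ⟨b, a - b, by omega, by rw [Nat.add_sub_cancel' h.le, hab]⟩
  have hper : ∀ m, g (a + m + t) = g (a + m) := by
    intro m
    induction m with
    | zero => exact hat
    | succ m ih =>
      rw [show a + (m + 1) + t = a + m + t + 1 by ring, hsucc, ih, ← add_assoc, hsucc]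
  have hper' : ∀ r m, g (a + m + r * t) = g (a + m) := by
    intro r m
    induction r with
    | zero => simp
    | succ r ih => rw [show a + m + (r + 1) * t = a + (m + r * t) + t by ring, hper, ← ih]; ring_nf
  -- The level `(k + a + 1) * t` is a multiple of the period `t` beyond the preperiod, so all its
  -- positive multiples have the same label map.
  obtain ⟨d, hd⟩ := Nat.exists_eq_add_of_le (show k + a ≤ (k + a + 1) * t by nlinarith)
  refine ⟨(k + a + 1) * t, g (a + d), by positivity, ?_, fun j hj => ?_⟩
  · rw [hd, add_assoc]
    exact hl _
  · obtain ⟨j, rfl⟩ := Nat.exists_eq_add_of_le hj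
    have hlev : (1 + j) * ((k + a + 1) * t) = k + (a + d + j * (k + a + 1) * t) := by
      rw [mul_assoc j, add_mul, one_mul, ← add_assoc, ← add_assoc, ← hd]
    rw [hlev, (hl _).isLabelMap_iff hθ hp haper hS (hel _), ← hper' (j * (k + a + 1)) d]
    exact hg _

end Chains

/-! ### Minimality of the speedup versus primitivity of the substitution -/

section Minimality

variable {A : Type*} [TopologicalSpace A] {θ : A → List A}
  {S : subshift θ ≃ₜ subshift θ} {p : subshift θ → ℕ} {c : ℕ} {e : Fin c → ℕ}

/-- In a compact space, a minimal homeomorphism has bounded forward return times to open sets. -/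
theorem IsMinimalHomeo.exists_return_time {X : Type*} [TopologicalSpace X] [CompactSpace X]
    {f : X ≃ₜ X} (hf : IsMinimalHomeo f) {U : Set X} (hU : IsOpen U) (hne : U.Nonempty) :
    ∃ N : ℕ, ∀ x, ∃ n ≤ N, f^[n] x ∈ U := by
  obtain ⟨I, hI⟩ := isCompact_univ.elim_finite_subcover (fun j : ℤ => ⇑(f ^ j) ⁻¹' U)
    (fun j => hU.preimage (f ^ j).continuous) (by
      intro x _
      obtain ⟨_, hy, j, rfl⟩ := (hf x).inter_open_nonempty U hU hne
      exact Set.mem_iUnion.2 ⟨j, hy⟩)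
  set N := I.sup Int.natAbs with hN
  -- The cover is applied to `f^N x`, so that the exponent `j + N` is nonnegative even for negative
  -- `j`.
  refine ⟨2 * N, fun x => ?_⟩
  obtain ⟨j, hj, hjU⟩ := Set.mem_iUnion₂.1 (hI (Set.mem_univ (f^[N] x)))
  have hle : j.natAbs ≤ N := Finset.le_sup (f := Int.natAbs) hj
  refine ⟨(j + N).toNat, by omega, ?_⟩
  have h : f^[(j + N).toNat] x = (f ^ j) (f^[N] x) := by
    rw [← zpow_natCast_apply, ← zpow_natCast_apply]
    show _ = (f ^ j * f ^ (N : ℤ)) x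
    rw [← zpow_add, Int.toNat_of_nonneg (by omega)]
  rw [h]
  exact hjU

theorem isPrimitive_symbolLabel_of_isMinimal [Finite A] [DiscreteTopology A] (hθ : IsPrimitive θ)
    (hp : IsProper θ) (haper : IsAperiodic θ) (hS : IsBoundedSpeedup (Speedup.shift θ) S p)
    {K : ℕ} (hK : 0 < K) (hlarge : IsLarge θ p K) (he : IsEntryList θ p K e)
    {π : A → Fin c → Fin c} (hπ : Transfers θ p e K π)
    (hcomp : ∀ i ℓ, (iter θ K i).foldl (fun ℓ i => π i ℓ) ℓ = π i ℓ) (hmin : IsMinimalHomeo S) :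
    IsPrimitive (symbolLabel θ K π) := by
  have hlen : ∀ i, Filter.Tendsto (fun n => (iter θ (n * K) i).length) Filter.atTop
      Filter.atTop := fun i =>
    (hθ.length_tendsto i).comp (Filter.tendsto_id.atTop_mul_const' hK)
  refine ⟨?_, fun q => ?_⟩
  swap
  · simpa only [iter_symbolLabel hcomp, length_labelWord] using hlen q.1
  rintro ⟨i, ℓ⟩ ⟨i', ℓ'⟩
  have := compactSpace_subshift θ
  obtain ⟨b, hb⟩ := base_nonempty hθ hp K i'
  have hlow : e ℓ' < height θ K i' := (entries_lt hS (he.mem hb ℓ')).trans (hlarge.tall i')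
  obtain ⟨N, hN⟩ := hmin.exists_return_time (isOpen_floor hθ hp haper hlow) ⟨_, b, hb, rfl⟩
  -- `N` jumps from the entry `e ℓ` climb at most this high, so the visit to the target floor
  -- happens inside the column.
  obtain ⟨n, hn⟩ := ((hlen i).eventually_gt_atTop (e ℓ + N * maxJump p)).exists
  refine ⟨n, ?_⟩
  rw [iter_symbolLabel hcomp, mem_labelWord_iff]
  obtain ⟨x, hx⟩ := base_nonempty hθ hp (K + n * K) i
  obtain ⟨t, ht, hmem⟩ := hN ((Speedup.shift θ)^[e ℓ] x)
  rw [speedup_iterate hS] at hmem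
  have hpos : (jumpPos p x)^[t] (e ℓ) < ((iter θ (n * K) i).flatMap (iter θ K)).length := by
    refine lt_of_le_of_lt ((iterate_jumpPos_le hS x t _).trans
      (Nat.add_le_add_left (Nat.mul_le_mul_right _ ht) _)) (hn.trans_le ?_)
    exact length_le_length_flatMap _ _ fun a _ => hθ.iter_ne_nil K a
  obtain ⟨u, a, v, hi, h1, h2⟩ := exists_split hpos
  have hsub := base_subset_base hθ hx hi
  have hfl : (Speedup.shift θ)^[(jumpPos p x)^[t] (e ℓ)] x
      ∈ floor θ K a ((jumpPos p x)^[t] (e ℓ) - (u.flatMap (iter θ K)).length) :=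
    ⟨_, hsub, by rw [← Function.iterate_add_apply, Nat.sub_add_cancel h1]⟩
  obtain ⟨rfl, heq⟩ := floor_unique hθ hp haper hfl (by rw [height]; omega) hmem hlow
  refine ⟨u, v, hi, ?_⟩
  obtain ⟨r, hr⟩ := hπ.chain_prefix hθ hx hi ℓ
  -- The path visits the subcolumn both at the entry found dynamically and at the one computed by
  -- folding `π`; it enters only once.
  exact he.target_unique haper hS hsub hr (show (jumpPos p x)^[t] (e ℓ) = _ + e ℓ' by omega)

theorem isMinimal_of_isPrimitive_symbolLabel [Finite A] [DiscreteTopology A] (hθ : IsPrimitive θ)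
    (hp : IsProper θ) (hS : IsBoundedSpeedup (Speedup.shift θ) S p)
    {K : ℕ} (hK : 0 < K) (hlarge : IsLarge θ p K) (he : IsEntryList θ p K e)
    {π : A → Fin c → Fin c} (hπ : ∀ j : ℕ, 1 ≤ j → Transfers θ p e (j * K) π)
    (hcomp : ∀ i ℓ, (iter θ K i).foldl (fun ℓ i => π i ℓ) ℓ = π i ℓ)
    (hprim : IsPrimitive (symbolLabel θ K π)) : IsMinimalHomeo S := by
  have hlev : ∀ j : ℕ, IsEntryList θ p ((j + 1) * K) e := fun j => by
    rw [add_mul, one_mul, add_comm]; exact he.add hθ _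
  obtain ⟨n₁, hn₁⟩ : ∃ n₁, ∀ n ≥ n₁, ∀ q q', q' ∈ iter (symbolLabel θ K π) n q := by
    obtain ⟨l, r, k₀, hlr⟩ := hp
    -- All high iterates of `(i, ℓ)` begin with `(l, ℓ)`, since the first letter keeps its label.
    refine exists_forall_mem_iter _ hprim.mem_iter (fun q => (l, q.2)) k₀ fun n hn q => ?_
    rw [iter_symbolLabel hcomp, mem_labelWord_iff]
    have h := hθ.head?_iter (fun a => (hlr a).1) (hn.trans (Nat.le_mul_of_pos_right n hK)) q.1
    obtain ⟨w, hw⟩ := List.head?_eq_some_iff.1 h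
    exact ⟨[], w, hw, rfl⟩
  intro x
  rw [dense_iff_inter_open]
  rintro U hU ⟨z, hz⟩
  obtain ⟨N, hN⟩ := exists_agree_of_isOpen hU hz
  obtain ⟨k₀, hk₀⟩ := exists_level_agree hθ hp N
  have hk : k₀ ≤ (k₀ + 1) * K := by nlinarith
  obtain ⟨i', j', hj', hzf⟩ := exists_mem_floor hθ hp ((k₀ + 1) * K) z
  have hfU : ∀ x' ∈ floor θ ((k₀ + 1) * K) i' j', x' ∈ U := fun x' hx' =>
    hN x' fun t h1 h2 => (hk₀ _ hk).2 i' j' hj' z hzf x' hx' t h1 h2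
  obtain ⟨i, s, hs, y, hy, hyx⟩ := exists_mem_floor hθ hp ((k₀ + 1) * K + n₁ * K) x
  obtain ⟨i₁, hy₁⟩ := exists_shift_height_mem_base hy
  set h := height θ ((k₀ + 1) * K + n₁ * K) i with hh
  set w := (Speedup.shift θ)^[h] y with hw
  have hwx : w = (Speedup.shift θ)^[h - s] x := by
    rw [← hyx, ← Function.iterate_add_apply, Nat.sub_add_cancel hs.le]
  have hel := (hlev k₀).add hθ (n₁ * K)
  have hadd := add_le_iterate_jumpPos hS x (h - s) 0
  -- After `h - s` jumps the path of `x` is past the base point `w` of the next column; traced back,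
  -- it entered that column at some `e ℓ`.
  obtain ⟨r, hr, m, hm⟩ := exists_entry hS w ((jumpPos p x)^[h - s] 0 - (h - s))
  obtain ⟨ℓ, rfl⟩ := hel.exists_eq hy₁ hr
  have horb : (Speedup.shift θ)^[e ℓ] w ∈ orbit S x := by
    have h1 : S^[m] ((Speedup.shift θ)^[e ℓ] w) = S^[h - s] x := by
      rw [speedup_iterate hS, hm, hwx, ← Function.iterate_add_apply,
        Nat.sub_add_cancel (by omega)]
      exact (speedup_iterate hS x (h - s) 0).symm
    rw [← orbit_iterate S x (h - s), ← h1, orbit_iterate]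
    exact mem_orbit_self _ _
  have htarget : ∀ q : A × Fin c, ∃ u v, iter θ (n₁ * K) i₁ = u ++ q.1 :: v ∧
      u.foldl (fun ℓ i => π i ℓ) ℓ = q.2 := by
    intro q
    have := hn₁ n₁ le_rfl (i₁, ℓ) q
    rwa [iter_symbolLabel hcomp, mem_labelWord_iff] at this
  obtain ⟨b, hb⟩ := base_nonempty hθ hp ((k₀ + 1) * K) i'
  obtain ⟨r, hr, m₂, hm₂⟩ := exists_entry hS b j'
  obtain ⟨q, rfl⟩ := (hlev k₀).exists_eq hb hr
  -- `q` is the entry whose path runs through floor `j'` of column `i'`; primitivity makes the path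
  -- from `e ℓ` enter a copy of that column at `q`.
  obtain ⟨u, v, hi, hq⟩ := htarget (i', q)
  have hcol := base_subset_base hθ hy₁ hi
  obtain ⟨r, hr⟩ := (hπ (k₀ + 1) (by omega)).chain_prefix hθ hy₁ hi ℓ
  rw [hq] at hr
  have hlarge' : IsLarge θ p ((k₀ + 1) * K) := by
    rw [add_mul, one_mul, add_comm]; exact hlarge.add hθ _
  have hm₃ := hlarge'.iterate_jumpPos_eq hS hb hcol m₂ (by rw [hm₂]; exact hj')
  rw [hm₂] at hm₃
  refine ⟨_, hfU _ ⟨_, hcol, rfl⟩, ?_⟩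
  rw [hm₃, ← speedup_iterate hS, ← Function.iterate_add_apply, add_comm (e q), ← hr,
    ← speedup_iterate hS, ← orbit_eq_of_mem horb, ← orbit_iterate S _ r]
  exact iterate_mem_orbit _ _ _

end Minimality

end Speedup

theorem mainTheorem9 {A : Type*} [Finite A] [TopologicalSpace A] [DiscreteTopology A]
    (θ : A → List A) (hproper : Speedup.IsProper θ) (hprim : Speedup.IsPrimitive θ)
    (haper : Speedup.IsAperiodic θ)
    (S : Speedup.subshift θ ≃ₜ Speedup.subshift θ) (p : Speedup.subshift θ → ℕ)
    (hS : Speedup.IsBoundedSpeedup (Speedup.shift θ) S p) :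
    ∃ c : ℕ, 0 < c ∧ Speedup.IsOrbitNumber (Speedup.shift θ) S c ∧
      (∃ (K : ℕ) (π : A → Fin c → Fin c), Speedup.IsStableLevel θ S p K π) ∧
      ∀ (K : ℕ) (π : A → Fin c → Fin c), Speedup.IsStableLevel θ S p K π →
        (Speedup.IsPrimitive (Speedup.symbolLabel θ K π) ↔ Speedup.IsMinimalHomeo S) := by
  open Speedup in
  obtain ⟨k₀, hk₀⟩ := exists_isLarge hprim hproper haper hS
  have hbase : ∀ k, ∃ b, b ∈ ⋃ i, base θ k i := fun k => by
    obtain ⟨b, hb⟩ := base_nonempty hprim hproper k hproper.choose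
    exact ⟨b, Set.mem_iUnion.2 ⟨_, hb⟩⟩
  obtain ⟨b, hb⟩ := hbase k₀
  have hfin : (entries p b).Finite := (Set.finite_Iio (maxJump p)).subset fun e he =>
    entries_lt hS he
  have hcard : (entries p b).encard = ((entries p b).ncard : ℕ∞) :=
    hfin.cast_ncard_eq.symm
  have hnum := ((hk₀ k₀ le_rfl).isOrbitNumber_iff hprim hproper haper hS hb _).2 hcard
  refine ⟨(entries p b).ncard, (Set.ncard_pos hfin).2 ⟨0, zero_mem_entries hS b⟩, hnum, ?_, ?_⟩
  · obtain ⟨e, he⟩ := (hk₀ k₀ le_rfl).exists_isEntryList hS hb hcard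
    exact exists_isStableLevel hprim hproper haper hS (hk₀ k₀ le_rfl) he
  · intro K π hK
    obtain ⟨b', hb'⟩ := hbase K
    obtain ⟨e, he⟩ := hK.large.exists_isEntryList hS hb'
      ((hK.large.isOrbitNumber_iff hprim hproper haper hS hb' _).1 hnum)
    have htrans : ∀ j : ℕ, 1 ≤ j → Transfers θ p e (j * K) π := by
      intro j hj
      have h := hK.labelMap j hj
      obtain ⟨j, rfl⟩ := Nat.exists_eq_add_of_le hj
      rw [add_mul, one_mul] at h ⊢
      exact ((hK.large.add hprim _).isLabelMap_iff hprim hproper haper hS (he.add hprim _) π).1 h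
    have h1 : Transfers θ p e K π := by simpa using htrans 1 le_rfl
    -- The composite of `π` along `θ^K(i)` is the label map of level `2K`, which equals `π` by
    -- stability.
    have hcomp : ∀ i ℓ, (iter θ K i).foldl (fun ℓ i => π i ℓ) ℓ = π i ℓ := by
      have h2 := htrans 2 (by omega)
      rw [two_mul] at h2
      intro i ℓ
      exact congrFun (congrFun ((h1.add hprim K).unique hprim hproper haper hS
        (he.add hprim K) h2) i) ℓ
    exact ⟨isMinimal_of_isPrimitive_symbolLabel hprim hproper hS hK.pos hK.large he htrans
      hcomp, isPrimitive_symbolLabel_of_isMinimal hprim hproper haper hS hK.pos hK.large he h1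
      hcomp⟩
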